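/- Let $n\ge 1$. Write $B(x,r)$ for balls in $\mathbb R^n$, $|E|$ for Lebesgue measure. Functions are real-valued (or, throughout, complex-valued). For $b\in L^1_{\rm loc}(\mathbb R^n)$ and a ball $B=B(x_0,r)$ put $c_B=\frac1{|B|}\int_B b$ if $r<1$ and $c_B=0$ if $r\ge 1$. Let $\|b\|_{\rm bmo}=\sup_B \frac1{|B|}\int_B|b-c_B|$ and $\|b\|_{{\rm bmo},2}=\bigl(\sup_B \frac1{|B|}\int_B|b-c_B|^2\bigr)^{1/2}$, the suprema being over all balls; $b\in{\rm bmo}(\mathbb R^n)$ means that $\|b\|_{\rm bmo}<\infty$. For $b\in{\rm bmo}(\mathbb R^n)$, a function $a\in L^2(\mathbb R^n)$ is an approximate $h^1_b$ atom if there is a ball $B=B(x_0,r)$, $r>0$, such that $a=0$ almost everywhere outside $B$, $\|a\|_{L^2}\le |B|^{-1/2}$, $$\Bigl|\int a\Bigr|\le \frac1{[\log(1+r^{-1})]^2}\quad\text{and}\quad \Bigl|\int a\,(b-c_B)\Bigr|\le\frac{\|b\|_{{\rm bmo},2}}{\log(1+r^{-1})}.$$ The local commutator grand maximal function is $$\mathcal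 M_b a(x)=\sup_{\phi}\Bigl|\int_{\mathbb R^n}[b(x)-b(y)]\,a(y)\,\phi(y)\,dy\Bigr|,$$ the supremum being over all $\phi\in C^1(\mathbb R^n)$ for which there is $0<t<1$ with $\operatorname{supp}\phi\subset B(x,t)$, $\|\phi\|_{L^\infty}\le|B(x,t)|^{-1}$ and $\|\nabla\phi\|_{L^\infty}\le [t\,|B(x,t)|]^{-1}$. Then there is a constant $C$, depending only on $n$, such that for every $b\in{\rm bmo}(\mathbb R^n)$ and every approximate $h^1_b$ atom $a$, the function $\mathcal M_b a$ is Lebesgue measurable and $$\|\mathcal M_b a\|_{L^1(\mathbb R^n)}\le C\,\|b\|_{\rm bmo}.$$ -/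

import Mathlib

open MeasureTheory
open scoped ENNReal NNReal

namespace LocalHardy

noncomputable section

/-- The constant `c_B` of a function `b` and the ball `B = B(x₀, r)`: the mean of `b` over `B` if
`r < 1`, and `0` if `r ≥ 1`. -/
def ballConst {𝕜 : Type*} [RCLike 𝕜] {n : ℕ} (b : EuclideanSpace ℝ (Fin n) → 𝕜)
    (x₀ : EuclideanSpace ℝ (Fin n)) (r : ℝ) : 𝕜 :=
  if r < 1 then ⨍ y in Metric.ball x₀ r, b y else 0

/-- `‖b‖_{bmo} = sup_B ⨍_B |b - c_B|`, the supremum being over all balls (small and large). -/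
def bmoNorm {𝕜 : Type*} [RCLike 𝕜] {n : ℕ} (b : EuclideanSpace ℝ (Fin n) → 𝕜) : ℝ≥0∞ :=
  ⨆ (x₀ : EuclideanSpace ℝ (Fin n)) (r : ℝ) (_ : 0 < r),
    ⨍⁻ y in Metric.ball x₀ r, ‖b y - ballConst b x₀ r‖ₑ ∂volume

/-- `‖b‖_{bmo,p} = (sup_B ⨍_B |b - c_B|^p)^{1/p}`. -/
def bmoNormExp {𝕜 : Type*} [RCLike 𝕜] {n : ℕ} (p : ℝ)
    (b : EuclideanSpace ℝ (Fin n) → 𝕜) : ℝ≥0∞ :=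
  (⨆ (x₀ : EuclideanSpace ℝ (Fin n)) (r : ℝ) (_ : 0 < r),
    ⨍⁻ y in Metric.ball x₀ r, ‖b y - ballConst b x₀ r‖ₑ ^ p ∂volume) ^ (1 / p)

/-- The (nonhomogeneous) space `bmo(ℝⁿ)`. -/
def IsBmo {𝕜 : Type*} [RCLike 𝕜] {n : ℕ} (b : EuclideanSpace ℝ (Fin n) → 𝕜) : Prop :=
  LocallyIntegrable b volume ∧ bmoNorm b < ∞

/-- The test functions at `x`: `C¹` functions `φ` for which there is `0 < t < 1` with
`supp φ ⊆ B(x, t)`, `‖φ‖_∞ ≤ |B(x, t)|⁻¹` and `‖∇φ‖_∞ ≤ (t |B(x, t)|)⁻¹`. -/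
def testFunctions (𝕜 : Type*) [RCLike 𝕜] {n : ℕ} (x : EuclideanSpace ℝ (Fin n)) :
    Set (EuclideanSpace ℝ (Fin n) → 𝕜) :=
  {φ | ContDiff ℝ 1 φ ∧ ∃ t : ℝ, 0 < t ∧ t < 1 ∧
    tsupport φ ⊆ Metric.ball x t ∧
    (∀ y, ‖φ y‖ ≤ (volume.real (Metric.ball x t))⁻¹) ∧
    (∀ y, ‖fderiv ℝ φ y‖ ≤ (t * volume.real (Metric.ball x t))⁻¹)}

/-- The local grand maximal function `sup_φ |⟨f, φ⟩|` of a locally integrable function `f`. -/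
def grandMaximal {𝕜 : Type*} [RCLike 𝕜] {n : ℕ} (f : EuclideanSpace ℝ (Fin n) → 𝕜)
    (x : EuclideanSpace ℝ (Fin n)) : ℝ≥0∞ :=
  ⨆ φ ∈ testFunctions 𝕜 x, ‖∫ y, f y * φ y‖ₑ

/-- The local commutator grand maximal function: at `x`, the grand maximal function of
`b(x) f(·) - b(·) f(·)`, evaluated at `x`. -/
def commutatorMaximal {𝕜 : Type*} [RCLike 𝕜] {n : ℕ} (b f : EuclideanSpace ℝ (Fin n) → 𝕜)
    (x : EuclideanSpace ℝ (Fin n)) : ℝ≥0∞ :=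
  grandMaximal (fun y => b x * f y - b y * f y) x

/-- Approximate `h¹_b` atoms. As usual for classes of functions, the support condition is
understood almost everywhere. -/
def IsApproxAtom {𝕜 : Type*} [RCLike 𝕜] {n : ℕ} (b a : EuclideanSpace ℝ (Fin n) → 𝕜) : Prop :=
  MemLp a 2 volume ∧ ∃ (x₀ : EuclideanSpace ℝ (Fin n)) (r : ℝ), 0 < r ∧
    (∀ᵐ y, y ∉ Metric.ball x₀ r → a y = 0) ∧
    eLpNorm a 2 volume ≤ volume (Metric.ball x₀ r) ^ (-(1 / 2) : ℝ) ∧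
    ‖∫ y, a y‖ ≤ 1 / (Real.log (1 + r⁻¹)) ^ 2 ∧
    ‖∫ y, a y * (b y - ballConst b x₀ r)‖ₑ ≤
      bmoNormExp 2 b / ENNReal.ofReal (Real.log (1 + r⁻¹))

end

end LocalHardy

namespace LocalHardy

open Metric Set Filter Topology

lemma rpow_mul_measure_le_of_lt_lintegral {α : Type*} [MeasurableSpace α] (μ : Measure α) {p : ℝ} (hp : 1 ≤ p) {g : α → ℝ≥0∞} {s : ℝ≥0∞}
    (hs : s ≠ ∞) {B : Set α} (hB : μ B ≠ ∞)
    (h : 2 * s * μ B ≤ ∫⁻ y in B, g y ∂μ) :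
    s ^ p * μ B ≤ ∫⁻ y in B, g y ^ p ∂μ := by
  have hsp : ∀ z : ℝ≥0∞, z ^ (p - 1) * z = z ^ p := fun z => by
    conv_lhs => rw [← ENNReal.rpow_one z, ← ENNReal.rpow_mul, one_mul]
    rw [← ENNReal.rpow_add_of_nonneg _ _ (by linarith) zero_le_one]
    congr 1; ring
  have hpt : ∀ z : ℝ≥0∞, s ^ (p - 1) * z ≤ s ^ p + z ^ p := fun z => by
    rcases le_total z s with hz | hz
    · refine le_trans ?_ le_self_add
      rw [← hsp s]; gcongr
    · refine le_trans ?_ le_add_self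
      rw [← hsp z]
      gcongr
  have hfin : s ^ (p - 1) ≠ ∞ := ENNReal.rpow_ne_top_of_nonneg (by linarith) hs
  have h1 : s ^ p * μ B + s ^ p * μ B ≤ s ^ p * μ B + ∫⁻ y in B, g y ^ p ∂μ := calc
    s ^ p * μ B + s ^ p * μ B = s ^ (p - 1) * (2 * s * μ B) := by rw [← hsp s]; ring
    _ ≤ s ^ (p - 1) * ∫⁻ y in B, g y ∂μ := by gcongr
    _ = ∫⁻ y in B, s ^ (p - 1) * g y ∂μ := (lintegral_const_mul' _ _ hfin).symm
    _ ≤ ∫⁻ y in B, (s ^ p + g y ^ p) ∂μ := lintegral_mono fun y => hpt _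
    _ = _ := by
      rw [lintegral_add_left measurable_const, setLIntegral_const]
  exact (ENNReal.add_le_add_iff_left
    (ENNReal.mul_ne_top (ENNReal.rpow_ne_top_of_nonneg (by linarith) hs) hB)).1 h1

/-- Kolmogorov's inequality: a weak `L^p` function is locally dominated by a measurable
`L^q` function, for `q < p`. -/
lemma exists_measurable_ge_of_weak {p q : ℝ} (hq : 0 < q) (hpq : q < p) :
    ∃ C : ℝ≥0, ∀ {α : Type*} [MeasurableSpace α] (ν : Measure α) (G : α → ℝ≥0∞) (V : ℝ≥0∞),
      (∀ k : ℕ, ((2 : ℝ≥0∞) ^ k) ^ p * ν {x | 2 ^ k < G x} ≤ V) →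
      ∃ H : α → ℝ≥0∞, Measurable H ∧ (∀ x, G x ^ q ≤ H x) ∧ ∫⁻ x, H x ∂ν ≤ ν univ + C * V := by
  have hr : (2 : ℝ≥0∞) ^ (q - p) < 1 :=
    ENNReal.rpow_lt_one_of_one_lt_of_neg (by norm_num) (by linarith)
  have hC : (2 : ℝ≥0∞) ^ q * ∑' k : ℕ, ((2 : ℝ≥0∞) ^ (q - p)) ^ k ≠ ∞ := by
    rw [ENNReal.tsum_geometric]
    exact ENNReal.mul_ne_top (by finiteness) (ENNReal.inv_ne_top.2 (tsub_pos_of_lt hr).ne')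
  refine ⟨((2 : ℝ≥0∞) ^ q * ∑' k : ℕ, ((2 : ℝ≥0∞) ^ (q - p)) ^ k).toNNReal, ?_⟩
  intro α _ ν G V h
  rw [ENNReal.coe_toNNReal hC]
  let T : ℕ → Set α := fun k => toMeasurable ν {x | 2 ^ k < G x}
  have hpt : ∀ x, G x ^ q ≤ 1 + ∑' k : ℕ, (T k).indicator (fun _ => ((2 : ℝ≥0∞) ^ (k + 1)) ^ q) x := by
    intro x
    have hT : ∀ k : ℕ, 2 ^ k < G x → (T k).indicator (fun _ => ((2 : ℝ≥0∞) ^ (k + 1)) ^ q) x =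
        ((2 : ℝ≥0∞) ^ (k + 1)) ^ q := fun k hk =>
      indicator_of_mem (subset_toMeasurable ν {x | 2 ^ k < G x} hk) _
    rcases le_or_gt (G x) 1 with h1 | h1
    · exact (ENNReal.rpow_le_one h1 hq.le).trans le_self_add
    refine le_trans ?_ le_add_self
    rcases eq_or_ne (G x) ∞ with htop | htop
    · refine le_trans le_top ((ENNReal.tsum_const_eq_top_of_ne_zero (α := ℕ)
        one_ne_zero).symm.le.trans (ENNReal.tsum_le_tsum fun k => ?_))
      rw [hT k (htop ▸ ENNReal.pow_lt_top (by norm_num))]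
      exact ENNReal.one_le_rpow (one_le_pow₀ (by norm_num)) hq
    · have hex : ∃ k : ℕ, G x ≤ 2 ^ (k + 1) := by
        obtain ⟨m, hm⟩ := ENNReal.exists_nat_gt htop
        refine ⟨m, hm.le.trans ?_⟩
        exact_mod_cast (Nat.lt_two_pow_self.trans (Nat.pow_lt_pow_right one_lt_two m.lt_succ_self)).le
      classical
      have hlt : 2 ^ Nat.find hex < G x := by
        rcases Nat.eq_zero_or_pos (Nat.find hex) with h0 | h0
        · rw [h0]; simpa using h1
        · have := Nat.find_min hex (m := Nat.find hex - 1) (by omega)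
          rwa [show Nat.find hex - 1 + 1 = Nat.find hex by omega, not_le] at this
      refine le_trans ?_ (ENNReal.le_tsum (Nat.find hex))
      rw [hT _ hlt]
      gcongr
      exact Nat.find_spec hex
  have hm : ∀ k : ℕ, Measurable ((T k).indicator (fun _ => ((2 : ℝ≥0∞) ^ (k + 1)) ^ q)) := fun k =>
    measurable_const.indicator (measurableSet_toMeasurable ν _)
  refine ⟨_, measurable_const.add (Measurable.tsum hm), hpt, ?_⟩
  calc ∫⁻ x, 1 + ∑' k : ℕ, (T k).indicator (fun _ => ((2 : ℝ≥0∞) ^ (k + 1)) ^ q) x ∂ν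
      = ν univ + ∑' k : ℕ, ((2 : ℝ≥0∞) ^ (k + 1)) ^ q * ν (T k) := by
        rw [lintegral_add_left measurable_const, lintegral_one, lintegral_tsum]
        · congr 2 with k
          exact lintegral_indicator_const (measurableSet_toMeasurable ν _) _
        · exact fun k => (hm k).aemeasurable
    _ ≤ ν univ + ∑' k : ℕ, (2 : ℝ≥0∞) ^ q * ((2 : ℝ≥0∞) ^ (q - p)) ^ k * V := by
        refine add_le_add_right (ENNReal.tsum_le_tsum fun k => ?_) _
        rw [measure_toMeasurable]
        refine le_trans (le_of_eq ?_) (mul_le_mul_right (h k) _)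
        rw [← mul_assoc]
        congr 1
        rw [pow_succ', ENNReal.mul_rpow_of_nonneg _ _ hq.le, mul_assoc]
        congr 1
        simp_rw [← ENNReal.rpow_natCast, ← ENNReal.rpow_mul]
        rw [← ENNReal.rpow_add _ _ (by norm_num) (by norm_num)]
        congr 1; ring
    _ = _ := by rw [ENNReal.tsum_mul_right, ENNReal.tsum_mul_left]

/-- The local Hardy–Littlewood maximal function. -/
noncomputable def localMaximal {E : Type*} [PseudoMetricSpace E] [MeasurableSpace E]
    (μ : Measure E) (f : E → ℝ≥0∞) (x : E) : ℝ≥0∞ :=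
  ⨆ (t : ℝ) (_ : 0 < t) (_ : t < 1), (∫⁻ y in ball x t, f y ∂μ) / μ (ball x t)

lemma localMaximal_const_mul {E : Type*} [PseudoMetricSpace E] [MeasurableSpace E]
    {μ : Measure E} (g : E → ℝ≥0∞) {k : ℝ≥0∞} (hk : k ≠ ∞) (x : E) :
    localMaximal μ (fun y => k * g y) x = k * localMaximal μ g x := by
  simp only [localMaximal, lintegral_const_mul' k _ hk, mul_div_assoc, ENNReal.mul_iSup]

section Doubling

variable {E : Type*} [NormedAddCommGroup E] [NormedSpace ℝ E] [MeasurableSpace E] [BorelSpace E]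
  [FiniteDimensional ℝ E] (μ : Measure E) [μ.IsAddHaarMeasure]

lemma measure_ball_mul (x y : E) {s : ℝ} (hs : 0 < s) (r : ℝ) :
    μ (ball x (s * r)) = ENNReal.ofReal s ^ Module.finrank ℝ E * μ (ball y r) := by
  rw [Measure.addHaar_ball_mul_of_pos μ x hs r, Measure.addHaar_ball_center μ y,
    ENNReal.ofReal_pow hs.le]

/-- Vitali selection: among balls over which the integral of `f` is large, one finds countably many
whose fivefold enlargements cover all centers and have controlled total measure. -/
lemma exists_countable_covering_of_le_lintegral (f : E → ℝ≥0∞) (t : Set E) (ρ : E → ℝ) (R : ℝ)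
    (hpos : ∀ y ∈ t, 0 < ρ y) (hR : ∀ y ∈ t, ρ y ≤ R) (Λ : ℝ≥0∞) (S : Set E)
    (hS : ∀ y ∈ t, ball y (ρ y) ⊆ S)
    (h : ∀ y ∈ t, Λ * μ (ball y (ρ y)) ≤ ∫⁻ z in ball y (ρ y), f z ∂μ) :
    ∃ u ⊆ t, u.Countable ∧ t ⊆ ⋃ y ∈ u, ball y (5 * ρ y) ∧
      Λ * ∑' y : u, μ (ball (y : E) (5 * ρ y)) ≤
        5 ^ Module.finrank ℝ E * ∫⁻ z in S, f z ∂μ := by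
  obtain ⟨u, hut, hdis, hcov⟩ := Vitali.exists_disjoint_subfamily_covering_enlargement_ball
    t id ρ R hR 5 (by norm_num)
  simp only [id] at hdis hcov
  have hc : u.Countable := hdis.countable_of_isOpen (fun _ _ => isOpen_ball)
    (fun y hy => ⟨y, mem_ball_self (hpos y (hut hy))⟩)
  refine ⟨u, hut, hc, fun y hy => ?_, ?_⟩
  · obtain ⟨z, hz, hsub⟩ := hcov y hy
    exact mem_biUnion hz (hsub (mem_ball_self (hpos y hy)))
  · calc Λ * ∑' y : u, μ (ball (y : E) (5 * ρ y))
        = 5 ^ Module.finrank ℝ E * ∑' y : u, Λ * μ (ball (y : E) (ρ y)) := by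
          have h5 : ∀ y : u, μ (ball (y : E) (5 * ρ y)) =
              5 ^ Module.finrank ℝ E * μ (ball (y : E) (ρ y)) := fun y => by
            rw [measure_ball_mul μ _ (y : E) (by norm_num : (0 : ℝ) < 5)]
            norm_num
          simp_rw [h5]
          rw [ENNReal.tsum_mul_left, ENNReal.tsum_mul_left]
          ring
      _ ≤ 5 ^ Module.finrank ℝ E * ∑' y : u, ∫⁻ z in ball (y : E) (ρ y), f z ∂μ := by
          gcongr with y
          exact h y (hut y.2)
      _ = 5 ^ Module.finrank ℝ E * ∫⁻ z in ⋃ y ∈ u, ball (y : E) (ρ y), f z ∂μ := by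
          rw [lintegral_biUnion hc (fun _ _ => measurableSet_ball) hdis]
      _ ≤ _ := by
          gcongr
          exact iUnion₂_subset fun y hy => hS y (hut hy)

/-- The weak type `(p, p)` estimate for the local maximal function. -/
lemma rpow_mul_measure_localMaximal_le {p : ℝ} (hp : 1 ≤ p) (g : E → ℝ≥0∞) {s : ℝ≥0∞}
    (hs : s ≠ ∞) :
    s ^ p * μ {x | 2 * s < localMaximal μ g x} ≤
      5 ^ Module.finrank ℝ E * ∫⁻ y, g y ^ p ∂μ := by
  have key : ∀ x ∈ {x | 2 * s < localMaximal μ g x}, ∃ t : ℝ, 0 < t ∧ t < 1 ∧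
      s ^ p * μ (ball x t) ≤ ∫⁻ y in ball x t, g y ^ p ∂μ := by
    intro x hx
    simp only [localMaximal, mem_ofPred_eq, lt_iSup_iff] at hx
    obtain ⟨t, ht, ht1, h⟩ := hx
    exact ⟨t, ht, ht1, rpow_mul_measure_le_of_lt_lintegral μ hp hs measure_ball_lt_top.ne
      (ENNReal.mul_lt_of_lt_div h).le⟩
  choose! ρ hρ using key
  obtain ⟨u, -, hc, hcov, hle⟩ := exists_countable_covering_of_le_lintegral μ
    (fun y => g y ^ p) _ ρ 1 (fun y hy => (hρ y hy).1) (fun y hy => (hρ y hy).2.1.le) (s ^ p) univ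
    (fun _ _ => subset_univ _) (fun y hy => (hρ y hy).2.2)
  rw [setLIntegral_univ] at hle
  refine le_trans ?_ hle
  gcongr
  exact (measure_mono hcov).trans (measure_biUnion_le μ hc _)

end Doubling

lemma tsum_pow_mul_inv_two_pow_ne_top (m : ℕ) :
    ∑' k : ℕ, (((k + 1 : ℕ) : ℝ≥0∞)) ^ m * 2⁻¹ ^ k ≠ ∞ := by
  have h1 : Summable fun k : ℕ => ((k + 1 : ℕ) : ℝ) ^ m * 2⁻¹ ^ k := by
    have h2 := ((summable_nat_add_iff 1).2 (summable_pow_mul_geometric_of_norm_lt_one m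
      (r := (2⁻¹ : ℝ)) (by norm_num))).mul_left 2
    refine h2.congr fun k => ?_
    rw [pow_succ]; ring
  have h3 : Summable fun k : ℕ => ((k + 1 : ℕ) : ℝ≥0) ^ m * 2⁻¹ ^ k := by
    rw [← NNReal.summable_coe]
    refine h1.congr fun k => ?_
    push_cast
    rfl
  have h4 := ENNReal.tsum_coe_ne_top_iff_summable.2 h3
  convert h4 using 3 with k
  simp [ENNReal.coe_inv, ENNReal.inv_pow]

section JohnNirenberg

variable {E : Type*} [MeasurableSpace E] {F : Type*} [NormedAddCommGroup F] (μ : Measure E)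

lemma lintegral_enorm_sub_le (b : E → F) (B : Set E) (c c' : F) :
    ∫⁻ y in B, ‖b y - c‖ₑ ∂μ ≤ ∫⁻ y in B, ‖b y - c'‖ₑ ∂μ + ‖c' - c‖ₑ * μ B := calc
  ∫⁻ y in B, ‖b y - c‖ₑ ∂μ ≤ ∫⁻ y in B, (‖b y - c'‖ₑ + ‖c' - c‖ₑ) ∂μ :=
    lintegral_mono fun y => by
      simpa using enorm_add_le (b y - c') (c' - c)
  _ = _ := by rw [lintegral_add_right _ measurable_const, setLIntegral_const]

lemma enorm_sub_mul_measure_le {b : E → F} (hb : AEStronglyMeasurable b μ) (B : Set E) (c c' : F) :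
    ‖c' - c‖ₑ * μ B ≤ ∫⁻ y in B, ‖b y - c'‖ₑ ∂μ + ∫⁻ y in B, ‖b y - c‖ₑ ∂μ := calc
  ‖c' - c‖ₑ * μ B = ∫⁻ y in B, ‖c' - c‖ₑ ∂μ := by rw [setLIntegral_const]
  _ ≤ ∫⁻ y in B, (‖b y - c'‖ₑ + ‖b y - c‖ₑ) ∂μ := lintegral_mono fun y => by
      simpa [enorm_sub_rev c' (b y)] using enorm_add_le (c' - b y) (b y - c)
  _ = _ := by exact lintegral_add_left' (hb.sub aestronglyMeasurable_const).enorm.restrict _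

/-- The stopping radius in the Calderón–Zygmund argument. -/
lemma exists_stopping_radius {E : Type*} [PseudoMetricSpace E] [MeasurableSpace E]
    {μ : Measure E} {f : E → ℝ≥0∞} {Λ : ℝ≥0∞} {y : E} {r : ℝ} (hr : 0 < r)
    (h0 : ∫⁻ z in ball y r, f z ∂μ ≤ Λ * μ (ball y r))
    (hex : ∃ k : ℕ, Λ * μ (ball y (r * (1 / 5) ^ k)) < ∫⁻ z in ball y (r * (1 / 5) ^ k), f z ∂μ) :
    ∃ ρ : ℝ, 0 < ρ ∧ 5 * ρ ≤ r ∧ Λ * μ (ball y ρ) ≤ ∫⁻ z in ball y ρ, f z ∂μ ∧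
      ∫⁻ z in ball y (5 * ρ), f z ∂μ ≤ Λ * μ (ball y (5 * ρ)) := by
  classical
  have hk : Nat.find hex ≠ 0 := fun hk => by
    have := Nat.find_spec hex
    rw [hk, pow_zero, mul_one] at this
    exact this.not_ge h0
  obtain ⟨m, hm⟩ := Nat.exists_eq_succ_of_ne_zero hk
  have h5 : 5 * (r * (1 / 5) ^ (m + 1)) = r * (1 / 5) ^ m := by ring
  have h2 := Nat.find_min hex (m := m) (by omega)
  have h1 := Nat.find_spec hex
  rw [hm] at h1
  refine ⟨r * (1 / 5) ^ (m + 1), by positivity, ?_, h1.le, ?_⟩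
  · rw [h5]
    exact mul_le_of_le_one_right hr.le (pow_le_one₀ (by norm_num) (by norm_num))
  · rw [h5]; exact not_lt.1 h2

variable [NormedAddCommGroup E] [NormedSpace ℝ E] [BorelSpace E]
  [FiniteDimensional ℝ E] [μ.IsAddHaarMeasure]

/-- Lebesgue differentiation along a sequence of shrinking balls. -/
lemma ae_tendsto_lintegral_enorm_sub_div_ball {b : E → F} (hb : LocallyIntegrable b μ)
    {δ : ℕ → ℝ} (hδ : ∀ k, 0 < δ k) (hlim : Tendsto δ atTop (𝓝 0)) :
    ∀ᵐ y ∂μ, Tendsto (fun k => (∫⁻ z in ball y (δ k), ‖b z - b y‖ₑ ∂μ) / μ (ball y (δ k))) atTop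
      (𝓝 0) := by
  filter_upwards [(IsUnifLocDoublingMeasure.vitaliFamily μ 1).ae_tendsto_lintegral_enorm_sub_div hb]
    with y hy
  have h := hy.comp (IsUnifLocDoublingMeasure.tendsto_closedBall_filterAt μ (K := 1) (fun _ : ℕ => y)
    δ (tendsto_nhdsWithin_iff.2 ⟨hlim, Eventually.of_forall hδ⟩)
    (Eventually.of_forall fun k => mem_closedBall_self (by simpa using (hδ k).le)))
  refine tendsto_of_tendsto_of_tendsto_of_le_of_le tendsto_const_nhds h (fun _ => zero_le) fun k => ?_
  simp only [Function.comp]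
  rw [Measure.addHaar_closedBall μ y (hδ k).le, ← Measure.addHaar_ball_of_pos μ y (hδ k)]
  gcongr
  exact ball_subset_closedBall

/-- `b` has mean oscillation at most `N` over all balls, with respect to the constants `c`. -/
def HasOscillationLE (b : E → F) (c : E → ℝ → F) (N : ℝ≥0) : Prop :=
  ∀ (x : E) (r : ℝ), 0 < r → ∫⁻ y in ball x r, ‖b y - c x r‖ₑ ∂μ ≤ N * μ (ball x r)

variable {μ} {b : E → F} {c : E → ℝ → F} {N : ℝ≥0}

lemma HasOscillationLE.enorm_sub_le (h : HasOscillationLE μ b c N) (hb : AEStronglyMeasurable b μ)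
    {x x' : E} {s r : ℝ} (hs : 0 < s) (hr : 0 < r) (hsub : ball x' r ⊆ ball x (s * r)) :
    ‖c x' r - c x (s * r)‖ₑ ≤ (1 + ENNReal.ofReal s ^ Module.finrank ℝ E) * N := by
  have h0 : μ (ball x' r) ≠ 0 := (measure_ball_pos μ x' hr).ne'
  rw [← ENNReal.mul_le_mul_iff_left h0 measure_ball_lt_top.ne]
  calc _ ≤ _ := enorm_sub_mul_measure_le μ hb _ _ _
    _ ≤ N * μ (ball x' r) + ∫⁻ y in ball x (s * r), ‖b y - c x (s * r)‖ₑ ∂μ := by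
      gcongr
      exact h x' r hr
    _ ≤ N * μ (ball x' r) + N * μ (ball x (s * r)) := by
      gcongr
      exact h x _ (mul_pos hs hr)
    _ = _ := by rw [measure_ball_mul μ x x' hs r]; ring

lemma HasOscillationLE.lintegral_two_mul_le (h : HasOscillationLE μ b c N)
    (hb : AEStronglyMeasurable b μ) (x : E) {r : ℝ} (hr : 0 < r) :
    ∫⁻ y in ball x (2 * r), ‖b y - c x r‖ₑ ∂μ ≤
      (2 + 2 ^ Module.finrank ℝ E) * 2 ^ Module.finrank ℝ E * N * μ (ball x r) := by
  have h1 := h.enorm_sub_le hb two_pos hr (ball_subset_ball (x := x) (by linarith : r ≤ 2 * r))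
  calc _ ≤ _ := lintegral_enorm_sub_le μ b _ _ (c x (2 * r))
    _ ≤ N * μ (ball x (2 * r)) +
        (1 + ENNReal.ofReal 2 ^ Module.finrank ℝ E) * N * μ (ball x (2 * r)) := by
      rw [enorm_sub_rev]
      gcongr
      exact h x _ (by linarith)
    _ = _ := by
      rw [measure_ball_mul μ x x two_pos r]
      norm_num
      ring

lemma HasOscillationLE.measure_lt_step (h : HasOscillationLE μ b c N) (hb : LocallyIntegrable b μ)
    (hN : N ≠ 0) {K A l ε : ℝ≥0∞}
    (hA : A = 5 ^ Module.finrank ℝ E * ((2 + 2 ^ Module.finrank ℝ E) * 2 ^ Module.finrank ℝ E))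
    (hK : K = 2 * A + 1)
    (hP : ∀ (x : E) (r : ℝ), 0 < r →
      μ (ball x r ∩ {y | l < ‖b y - c x r‖ₑ}) ≤ ε * μ (ball x r)) (x : E) {r : ℝ} (hr : 0 < r) :
    μ (ball x r ∩ {y | l + K * N < ‖b y - c x r‖ₑ}) ≤ ε / 2 * μ (ball x r) := by
  have hbm := hb.aestronglyMeasurable
  have hN' : (N : ℝ≥0∞) ≠ 0 := by exact_mod_cast hN
  have hA0 : A ≠ 0 := by rw [hA]; positivity
  have hAtop : A ≠ ∞ := by rw [hA]; finiteness
  have h2B := h.lintegral_two_mul_le hbm x hr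
  set f : E → ℝ≥0∞ := fun y => ‖b y - c x r‖ₑ with hf
  have hlim : Tendsto (fun k : ℕ => r * (1 / 5 : ℝ) ^ k) atTop (𝓝 0) := by
    simpa using (tendsto_pow_atTop_nhds_zero_of_lt_one (r := (1 / 5 : ℝ)) (by norm_num)
      (by norm_num)).const_mul r
  have hleb := ae_tendsto_lintegral_enorm_sub_div_ball μ hb (δ := fun k => r * (1 / 5) ^ k)
    (fun k => by positivity) hlim
  let Leb : Set E := {y | Tendsto (fun k : ℕ => (∫⁻ z in ball y (r * (1 / 5) ^ k), ‖b z - b y‖ₑ ∂μ) /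
    μ (ball y (r * (1 / 5) ^ k))) atTop (𝓝 0)}
  set S : Set E := (ball x r ∩ {y | l + K * N < f y}) with hS
  have hsubB : ∀ y ∈ ball x r, ∀ ρ ≤ r, ball y ρ ⊆ ball x (2 * r) := fun y hy ρ hρ =>
    ball_subset_ball' (by linarith [mem_ball.1 hy])
  have hA1 : (2 + 2 ^ Module.finrank ℝ E) * 2 ^ Module.finrank ℝ E ≤ 2 * A := by
    rw [hA, ← mul_assoc]
    refine le_mul_of_one_le_left zero_le ?_
    exact_mod_cast Nat.one_le_iff_ne_zero.2 (by positivity)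
  have hsel : ∀ y ∈ S ∩ Leb, ∃ ρ : ℝ, 0 < ρ ∧ 5 * ρ ≤ r ∧
      2 * A * N * μ (ball y ρ) ≤ ∫⁻ z in ball y ρ, f z ∂μ ∧
      ∫⁻ z in ball y (5 * ρ), f z ∂μ ≤ 2 * A * N * μ (ball y (5 * ρ)) := by
    rintro y ⟨⟨hyB, hyl⟩, hyL⟩
    refine exists_stopping_radius hr ?_ ?_
    · calc ∫⁻ z in ball y r, f z ∂μ ≤ ∫⁻ z in ball x (2 * r), f z ∂μ :=
          lintegral_mono_set (hsubB y hyB r le_rfl)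
        _ ≤ _ := h2B
        _ ≤ _ := by
          rw [Measure.addHaar_ball_center μ x, Measure.addHaar_ball_center μ y]
          gcongr
    · obtain ⟨k, hk⟩ := ((tendsto_order.1 hyL).2 N (pos_iff_ne_zero.2 hN')).exists
      refine ⟨k, ?_⟩
      by_contra hcon
      rw [not_lt] at hcon
      have hpos : (0 : ℝ) < r * (1 / 5) ^ k := by positivity
      set B := ball y (r * (1 / 5) ^ k)
      have hB0 : μ B ≠ 0 := (measure_ball_pos μ y hpos).ne'
      have hB1 : μ B ≠ ∞ := measure_ball_lt_top.ne
      have h1 : ∫⁻ z in B, ‖b z - b y‖ₑ ∂μ ≤ N * μ B :=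
        (ENNReal.div_le_iff hB0 hB1).1 hk.le
      have h2 := enorm_sub_mul_measure_le μ hbm B (c x r) (b y)
      have h3 : f y * μ B ≤ (K * N) * μ B := calc
        f y * μ B ≤ _ := h2
        _ ≤ N * μ B + 2 * A * N * μ B := add_le_add h1 hcon
        _ = _ := by rw [hK]; ring
      exact ((le_add_self.trans_lt hyl).trans_le ((ENNReal.mul_le_mul_iff_left hB0 hB1).1 h3)).false
  choose! ρ hρ using hsel
  obtain ⟨u, hut, hc, hcov, hle⟩ := exists_countable_covering_of_le_lintegral μ f (S ∩ Leb) ρ r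
    (fun y hy => (hρ y hy).1) (fun y hy => by linarith [hρ y hy]) (2 * A * N) (ball x (2 * r))
    (fun y hy => hsubB y hy.1.1 _ (by linarith [hρ y hy])) (fun y hy => (hρ y hy).2.2.1)
  set T := ∑' y : u, μ (ball (y : E) (5 * ρ y))
  have hT : 2 * T ≤ μ (ball x r) := by
    have hne : A * N ≠ 0 := mul_ne_zero hA0 hN'
    rw [← ENNReal.mul_le_mul_iff_right hne (by finiteness)]
    calc A * N * (2 * T) = 2 * A * N * T := by ring
      _ ≤ _ := hle
      _ ≤ 5 ^ Module.finrank ℝ E * _ := mul_le_mul_right h2B _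
      _ = _ := by rw [hA]; ring
  have hsmall : ∀ y ∈ u, μ (S ∩ ball y (5 * ρ y)) ≤ ε * μ (ball y (5 * ρ y)) := by
    intro y hy
    obtain ⟨h1, -, -, h4⟩ := hρ y (hut hy)
    have h5 : 0 < 5 * ρ y := by linarith
    refine le_trans (measure_mono ?_) (hP y _ h5)
    rintro z ⟨⟨-, hz⟩, hzB⟩
    refine ⟨hzB, ?_⟩
    have hB0 : μ (ball y (5 * ρ y)) ≠ 0 := (measure_ball_pos μ y h5).ne'
    have h6 : ‖c y (5 * ρ y) - c x r‖ₑ ≤ K * N := by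
      rw [← ENNReal.mul_le_mul_iff_left hB0 measure_ball_lt_top.ne]
      calc _ ≤ _ := enorm_sub_mul_measure_le μ hbm _ _ _
        _ ≤ _ := add_le_add (h y _ h5) h4
        _ = _ := by rw [hK]; ring
    have h7 : f z ≤ ‖b z - c y (5 * ρ y)‖ₑ + K * N := by
      refine le_trans ?_ (add_le_add_right h6 _)
      simpa using enorm_add_le (b z - c y (5 * ρ y)) (c y (5 * ρ y) - c x r)
    exact lt_of_add_lt_add_right (lt_of_lt_of_le hz h7)
  calc μ S ≤ μ (S ∩ Leb) + μ Lebᶜ := by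
        refine (measure_mono fun y hy => ?_).trans (measure_union_le _ _)
        by_cases hL : y ∈ Leb
        · exact Or.inl ⟨hy, hL⟩
        · exact Or.inr hL
    _ = μ (S ∩ Leb) := by rw [show μ Lebᶜ = 0 from hleb, add_zero]
    _ ≤ μ (⋃ y ∈ u, S ∩ ball y (5 * ρ y)) := by
        refine measure_mono fun y hy => ?_
        obtain ⟨z, hz, hyz⟩ := mem_iUnion₂.1 (hcov hy)
        exact mem_biUnion hz ⟨hy.1, hyz⟩
    _ ≤ ∑' y : u, μ (S ∩ ball (y : E) (5 * ρ y)) := measure_biUnion_le μ hc _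
    _ ≤ ∑' y : u, ε * μ (ball (y : E) (5 * ρ y)) := ENNReal.tsum_le_tsum fun y => hsmall y y.2
    _ = ε / 2 * (2 * T) := by
        rw [ENNReal.tsum_mul_left, ← mul_assoc, ENNReal.div_mul_cancel two_ne_zero (by norm_num)]
    _ ≤ _ := by gcongr

lemma HasOscillationLE.measure_lt_le (h : HasOscillationLE μ b c N) (hb : LocallyIntegrable b μ)
    (hN : N ≠ 0) {K A : ℝ≥0∞}
    (hA : A = 5 ^ Module.finrank ℝ E * ((2 + 2 ^ Module.finrank ℝ E) * 2 ^ Module.finrank ℝ E))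
    (hK : K = 2 * A + 1) (k : ℕ) (x : E) {r : ℝ} (hr : 0 < r) :
    μ (ball x r ∩ {y | k * (K * N) < ‖b y - c x r‖ₑ}) ≤ 2⁻¹ ^ k * μ (ball x r) := by
  induction k generalizing x r with
  | zero => simpa using measure_mono inter_subset_left
  | succ k ih =>
    have := h.measure_lt_step hb hN hA hK (fun x r hr => ih x hr) x hr
    rw [ENNReal.div_eq_inv_mul, ← pow_succ'] at this
    push_cast
    rwa [add_mul, one_mul]

/-- The John–Nirenberg inequality, in the form of an `L^4` bound. -/
lemma exists_lintegral_pow_four_le (E : Type*) [MeasurableSpace E] [NormedAddCommGroup E]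
    [NormedSpace ℝ E] [BorelSpace E] [FiniteDimensional ℝ E] (F : Type*) [NormedAddCommGroup F]
    (μ : Measure E) [μ.IsAddHaarMeasure] :
    ∃ C : ℝ≥0, ∀ (b : E → F) (c : E → ℝ → F) (N : ℝ≥0), N ≠ 0 → LocallyIntegrable b μ →
      HasOscillationLE μ b c N → ∀ (x : E) (r : ℝ), 0 < r →
        ∫⁻ y in ball x r, ‖b y - c x r‖ₑ ^ 4 ∂μ ≤ C * N ^ 4 * μ (ball x r) := by
  obtain ⟨A, hA⟩ : ∃ A : ℝ≥0∞, A = 5 ^ Module.finrank ℝ E *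
    ((2 + 2 ^ Module.finrank ℝ E) * 2 ^ Module.finrank ℝ E) := ⟨_, rfl⟩
  obtain ⟨K, hK⟩ : ∃ K : ℝ≥0∞, K = 2 * A + 1 := ⟨_, rfl⟩
  have hKtop : K ≠ ∞ := by rw [hK, hA]; finiteness
  have hK0 : K ≠ 0 := by rw [hK]; positivity
  have hsum := tsum_pow_mul_inv_two_pow_ne_top 4
  have hC : K ^ 4 * ∑' k : ℕ, (((k + 1 : ℕ) : ℝ≥0∞)) ^ 4 * 2⁻¹ ^ k ≠ ∞ :=
    ENNReal.mul_ne_top (by finiteness) hsum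
  refine ⟨(K ^ 4 * ∑' k : ℕ, (((k + 1 : ℕ) : ℝ≥0∞)) ^ 4 * 2⁻¹ ^ k).toNNReal, ?_⟩
  intro b c N hN hb h x r hr
  rw [ENNReal.coe_toNNReal hC]
  have hN' : (N : ℝ≥0∞) ≠ 0 := by exact_mod_cast hN
  set ν := μ.restrict (ball x r)
  set f : E → ℝ≥0∞ := fun y => ‖b y - c x r‖ₑ with hf
  let T : ℕ → Set E := fun k => toMeasurable ν {y | k * (K * N) < f y}
  have hpt : ∀ y, f y ^ 4 ≤
      ∑' k : ℕ, (T k).indicator (fun _ => (((k + 1 : ℕ) : ℝ≥0∞) * (K * N)) ^ 4) y := by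
    intro y
    rcases eq_or_ne (f y) 0 with h0 | h0
    · simp [h0]
    have hex : ∃ k : ℕ, f y ≤ ((k + 1 : ℕ) : ℝ≥0∞) * (K * N) := by
      have hfin : f y / (K * N) ≠ ∞ := ENNReal.div_ne_top enorm_ne_top (mul_ne_zero hK0 hN')
      obtain ⟨m, hm⟩ := ENNReal.exists_nat_gt hfin
      refine ⟨m, ?_⟩
      rw [ENNReal.div_lt_iff (Or.inl (mul_ne_zero hK0 hN')) (Or.inl (by finiteness))] at hm
      refine hm.le.trans ?_
      gcongr
      exact m.le_succ
    classical
    have hlt : (Nat.find hex : ℝ≥0∞) * (K * N) < f y := by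
      rcases Nat.eq_zero_or_pos (Nat.find hex) with h1 | h1
      · rw [h1]; simpa using pos_iff_ne_zero.2 h0
      · have := Nat.find_min hex (m := Nat.find hex - 1) (by omega)
        rwa [show Nat.find hex - 1 + 1 = Nat.find hex by omega, not_le] at this
    refine le_trans ?_ (ENNReal.le_tsum (Nat.find hex))
    rw [indicator_of_mem (subset_toMeasurable ν {y | Nat.find hex * (K * N) < f y} hlt)]
    gcongr
    exact Nat.find_spec hex
  calc ∫⁻ y, f y ^ 4 ∂ν
      ≤ ∫⁻ y, ∑' k : ℕ, (T k).indicator (fun _ => (((k + 1 : ℕ) : ℝ≥0∞) * (K * N)) ^ 4) y ∂ν :=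
        lintegral_mono hpt
    _ = ∑' k : ℕ, (((k + 1 : ℕ) : ℝ≥0∞) * (K * N)) ^ 4 * ν (T k) := by
        rw [lintegral_tsum]
        · congr 1 with k
          exact lintegral_indicator_const (measurableSet_toMeasurable ν _) _
        · exact fun k => (measurable_const.indicator (measurableSet_toMeasurable ν _)).aemeasurable
    _ ≤ ∑' k : ℕ, K ^ 4 * ((((k + 1 : ℕ) : ℝ≥0∞)) ^ 4 * 2⁻¹ ^ k) * (N ^ 4 * μ (ball x r)) := by
        refine ENNReal.tsum_le_tsum fun k => ?_
        rw [measure_toMeasurable, Measure.restrict_apply' measurableSet_ball, inter_comm]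
        refine (mul_le_mul_right (h.measure_lt_le hb hN hA hK k x hr) _).trans (le_of_eq ?_)
        ring
    _ = _ := by rw [ENNReal.tsum_mul_right, ENNReal.tsum_mul_left]; ring

end JohnNirenberg

lemma lintegral_eq_setLIntegral_of_ae {α : Type*} [MeasurableSpace α] {μ : Measure α} {f : α → ℝ≥0∞}
    {B : Set α} (hB : MeasurableSet B) (h : ∀ᵐ x ∂μ, x ∉ B → f x = 0) :
    ∫⁻ x, f x ∂μ = ∫⁻ x in B, f x ∂μ := by
  rw [← lintegral_indicator hB]
  refine lintegral_congr_ae (h.mono fun x hx => ?_)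
  by_cases hxB : x ∈ B
  · rw [indicator_of_mem hxB]
  · rw [indicator_of_notMem hxB, hx hxB]

section Estimates

variable {E : Type*} [MeasurableSpace E] [NormedAddCommGroup E] [NormedSpace ℝ E] [BorelSpace E]
  [FiniteDimensional ℝ E] {F : Type*} [NormedAddCommGroup F] {μ : Measure E} [μ.IsAddHaarMeasure]
  {b : E → F} {c : E → ℝ → F} {N : ℝ≥0}

lemma HasOscillationLE.enorm_sub_two_pow_le (h : HasOscillationLE μ b c N)
    (hb : AEStronglyMeasurable b μ) (x : E) {r : ℝ} (hr : 0 < r) (j : ℕ) :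
    ‖c x r - c x (2 ^ j * r)‖ₑ ≤ j * (1 + 2 ^ Module.finrank ℝ E) * N := by
  induction j with
  | zero => simp
  | succ j ih =>
    have hj : 0 < 2 ^ j * r := by positivity
    have h1 := h.enorm_sub_le hb two_pos hj (ball_subset_ball (x := x)
      (by linarith : 2 ^ j * r ≤ 2 * (2 ^ j * r)))
    rw [ENNReal.ofReal_ofNat] at h1
    rw [pow_succ', mul_assoc]
    calc _ ≤ ‖c x r - c x (2 ^ j * r)‖ₑ + ‖c x (2 ^ j * r) - c x (2 * (2 ^ j * r))‖ₑ := by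
          simpa using enorm_add_le (c x r - c x (2 ^ j * r))
            (c x (2 ^ j * r) - c x (2 * (2 ^ j * r)))
      _ ≤ _ := add_le_add ih h1
      _ = _ := by push_cast; ring

lemma HasOscillationLE.lintegral_two_pow_le (h : HasOscillationLE μ b c N)
    (hb : AEStronglyMeasurable b μ) (x : E) {r : ℝ} (hr : 0 < r) (j : ℕ) :
    ∫⁻ y in ball x (2 ^ j * r), ‖b y - c x r‖ₑ ∂μ ≤
      (1 + j * (1 + 2 ^ Module.finrank ℝ E)) * N * μ (ball x (2 ^ j * r)) := by
  have h1 := h.enorm_sub_two_pow_le hb x hr j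
  rw [enorm_sub_rev] at h1
  calc _ ≤ _ := lintegral_enorm_sub_le μ b _ _ (c x (2 ^ j * r))
    _ ≤ N * μ (ball x (2 ^ j * r)) +
        j * (1 + 2 ^ Module.finrank ℝ E) * N * μ (ball x (2 ^ j * r)) := by
      gcongr
      exact h x _ (by positivity)
    _ = _ := by ring

lemma add_pow_four_le (x y : ℝ≥0∞) : (x + y) ^ 4 ≤ 16 * (x ^ 4 + y ^ 4) := by
  have h : ∀ {x y : ℝ≥0∞}, x ≤ y → (x + y) ^ 4 ≤ 16 * (x ^ 4 + y ^ 4) := fun {x y} hxy => calc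
    (x + y) ^ 4 ≤ (y + y) ^ 4 := by gcongr
    _ = 16 * y ^ 4 := by ring
    _ ≤ _ := by gcongr; exact le_add_self
  rcases le_total x y with hxy | hxy
  · exact h hxy
  · rw [add_comm x, add_comm (x ^ 4)]; exact h hxy

lemma HasOscillationLE.lintegral_two_mul_pow_four_le (h : HasOscillationLE μ b c N)
    (hb : AEStronglyMeasurable b μ) {C : ℝ≥0}
    (hC : ∀ (x : E) (r : ℝ), 0 < r →
      ∫⁻ y in ball x r, ‖b y - c x r‖ₑ ^ 4 ∂μ ≤ C * N ^ 4 * μ (ball x r))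
    (x : E) {r : ℝ} (hr : 0 < r) :
    ∫⁻ y in ball x (2 * r), ‖b y - c x r‖ₑ ^ 4 ∂μ ≤
      16 * (C + (1 + 2 ^ Module.finrank ℝ E) ^ 4) * 2 ^ Module.finrank ℝ E * N ^ 4 *
        μ (ball x r) := by
  have h1 := h.enorm_sub_le hb two_pos hr (ball_subset_ball (x := x) (by linarith : r ≤ 2 * r))
  rw [enorm_sub_rev, ENNReal.ofReal_ofNat] at h1
  calc ∫⁻ y in ball x (2 * r), ‖b y - c x r‖ₑ ^ 4 ∂μ
      ≤ ∫⁻ y in ball x (2 * r), 16 * (‖b y - c x (2 * r)‖ₑ ^ 4 +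
          ((1 + 2 ^ Module.finrank ℝ E) * N) ^ 4) ∂μ := by
        refine lintegral_mono fun y => ?_
        refine le_trans ?_ (add_pow_four_le _ _)
        gcongr
        refine le_trans ?_ (add_le_add_right h1 _)
        simpa using enorm_add_le (b y - c x (2 * r)) (c x (2 * r) - c x r)
    _ = 16 * (∫⁻ y in ball x (2 * r), ‖b y - c x (2 * r)‖ₑ ^ 4 ∂μ +
          ((1 + 2 ^ Module.finrank ℝ E) * N) ^ 4 * μ (ball x (2 * r))) := by
        rw [lintegral_const_mul' _ _ (by norm_num), lintegral_add_right _ measurable_const,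
          setLIntegral_const]
    _ ≤ 16 * (C * N ^ 4 * μ (ball x (2 * r)) +
          ((1 + 2 ^ Module.finrank ℝ E) * N) ^ 4 * μ (ball x (2 * r))) := by
        gcongr
        exact hC x _ (by linarith)
    _ = _ := by
        rw [measure_ball_mul μ x x two_pos r, ENNReal.ofReal_ofNat]
        ring

lemma exists_measurable_ge_localMaximal (μ : Measure E) [μ.IsAddHaarMeasure] {p q : ℝ} (hp : 1 ≤ p)
    (hq : 0 < q) (hpq : q < p) :
    ∃ C : ℝ≥0, ∀ (g : E → ℝ≥0∞) (S : Set E), ∃ H : E → ℝ≥0∞, Measurable H ∧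
      (∀ x, localMaximal μ g x ^ q ≤ H x) ∧ ∫⁻ x in S, H x ∂μ ≤ μ S + C * ∫⁻ x, g x ^ p ∂μ := by
  obtain ⟨C, hC⟩ := exists_measurable_ge_of_weak hq hpq
  have hD : (2 : ℝ≥0∞) ^ p * 5 ^ Module.finrank ℝ E ≠ ∞ := by
    have : (2 : ℝ≥0∞) ^ p ≠ ∞ := ENNReal.rpow_ne_top_of_nonneg (by linarith) (by norm_num)
    finiteness
  refine ⟨C * ((2 : ℝ≥0∞) ^ p * 5 ^ Module.finrank ℝ E).toNNReal, fun g S => ?_⟩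
  obtain ⟨H, hm, hle, hint⟩ := hC (μ.restrict S) (localMaximal μ g)
    ((2 : ℝ≥0∞) ^ p * 5 ^ Module.finrank ℝ E * ∫⁻ x, g x ^ p ∂μ) (fun k => by
      have h2 : 2 * (2 ^ k / 2) = (2 : ℝ≥0∞) ^ k := ENNReal.mul_div_cancel two_ne_zero (by norm_num)
      have h := rpow_mul_measure_localMaximal_le μ hp g (s := 2 ^ k / 2) (by finiteness)
      rw [h2] at h
      calc ((2 : ℝ≥0∞) ^ k) ^ p * μ.restrict S {x | 2 ^ k < localMaximal μ g x}
          ≤ (2 * (2 ^ k / 2)) ^ p * μ {x | 2 ^ k < localMaximal μ g x} := by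
            rw [h2]
            exact mul_le_mul_right (Measure.restrict_apply_le _ _) _
        _ = 2 ^ p * ((2 ^ k / 2) ^ p * μ {x | 2 ^ k < localMaximal μ g x}) := by
            rw [ENNReal.mul_rpow_of_nonneg _ _ (by linarith), mul_assoc]
        _ ≤ _ := by rw [mul_assoc]; gcongr)
  refine ⟨H, hm, hle, hint.trans (le_of_eq ?_)⟩
  rw [Measure.restrict_apply_univ, ENNReal.coe_mul, ENNReal.coe_toNNReal hD]
  ring

lemma mul_le_pow_four_add_rpow (x y : ℝ≥0∞) : x * y ≤ x ^ 4 + y ^ (4 / 3 : ℝ) := by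
  obtain ⟨z, rfl⟩ : ∃ z : ℝ≥0∞, y = z ^ 3 :=
    ⟨y ^ (1 / 3 : ℝ), by rw [← ENNReal.rpow_natCast, ← ENNReal.rpow_mul]; norm_num⟩
  have h4 : ∀ z : ℝ≥0∞, (z ^ 3) ^ (4 / 3 : ℝ) = z ^ 4 := fun z => by
    rw [← ENNReal.rpow_natCast, ← ENNReal.rpow_mul, ← ENNReal.rpow_natCast]; norm_num
  rw [h4]
  rcases le_total x z with h | h
  · refine le_trans ?_ le_add_self
    calc x * z ^ 3 ≤ z * z ^ 3 := by gcongr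
      _ = _ := by ring
  · refine le_trans ?_ le_self_add
    calc x * z ^ 3 ≤ x * x ^ 3 := by gcongr
      _ = _ := by ring

lemma mul_rpow_le_pow_four_add_sq (x y : ℝ≥0∞) :
    (x * y) ^ (4 / 3 : ℝ) ≤ x ^ 4 + y ^ 2 := by
  obtain ⟨z, rfl⟩ : ∃ z : ℝ≥0∞, y = z ^ 2 :=
    ⟨y ^ (1 / 2 : ℝ), by rw [← ENNReal.rpow_natCast, ← ENNReal.rpow_mul]; norm_num⟩
  have h4 : ∀ z : ℝ≥0∞, (z * z ^ 2) ^ (4 / 3 : ℝ) = z ^ 4 := fun z => by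
    rw [← pow_succ', ← ENNReal.rpow_natCast, ← ENNReal.rpow_mul, ← ENNReal.rpow_natCast]; norm_num
  rw [← pow_mul]
  rcases le_total x z with h | h
  · refine le_trans ?_ le_add_self
    rw [← h4 z]
    gcongr
  · refine le_trans ?_ le_self_add
    rw [← h4 x]
    gcongr

/-- The part of the estimate close to the ball supporting the atom. -/
lemma exists_lintegral_near_le (μ : Measure E) [μ.IsAddHaarMeasure] (K : ℝ≥0) :
    ∃ C : ℝ≥0, ∀ (u α : E → ℝ≥0∞) (x₀ : E) (r : ℝ), AEMeasurable u μ →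
      ∫⁻ x in ball x₀ (2 * r), u x ^ 4 ∂μ ≤ K * μ (ball x₀ r) →
      ∫⁻ x, α x ^ 2 ∂μ ≤ μ (ball x₀ r) →
      (∀ᵐ x ∂μ, x ∉ ball x₀ (2 * r) → α x = 0) →
      ∫⁻ x in ball x₀ (2 * r),
        (u x * localMaximal μ α x + localMaximal μ (fun y => u y * α y) x) ∂μ ≤
        C * μ (ball x₀ r) := by
  obtain ⟨C₁, hC₁⟩ := exists_measurable_ge_localMaximal μ (p := 2) (q := 4 / 3) (by norm_num)
    (by norm_num) (by norm_num)
  obtain ⟨C₂, hC₂⟩ := exists_measurable_ge_localMaximal μ (p := 4 / 3) (q := 1) (by norm_num)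
    (by norm_num) (by norm_num)
  refine ⟨K + (2 ^ Module.finrank ℝ E + C₁) + (2 ^ Module.finrank ℝ E + C₂ * (K + 1)), ?_⟩
  intro u α x₀ r hu hu4 hα hsupp
  set B := ball x₀ (2 * r)
  set V := μ (ball x₀ r)
  have hB : μ B = 2 ^ Module.finrank ℝ E * V := by
    rw [measure_ball_mul μ x₀ x₀ two_pos r, ENNReal.ofReal_ofNat]
  obtain ⟨H₁, hm₁, hle₁, hint₁⟩ := hC₁ α B
  obtain ⟨H₂, hm₂, hle₂, hint₂⟩ := hC₂ (fun y => u y * α y) B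
  have huα : ∫⁻ x, (u x * α x) ^ (4 / 3 : ℝ) ∂μ ≤ (K + 1) * V := calc
    ∫⁻ x, (u x * α x) ^ (4 / 3 : ℝ) ∂μ = ∫⁻ x in B, (u x * α x) ^ (4 / 3 : ℝ) ∂μ := 
      lintegral_eq_setLIntegral_of_ae measurableSet_ball
        (hsupp.mono fun x hx hxB => by simp [hx hxB])
    _ ≤ ∫⁻ x in B, (u x ^ 4 + α x ^ 2) ∂μ :=
      lintegral_mono fun x => mul_rpow_le_pow_four_add_sq _ _
    _ = ∫⁻ x in B, u x ^ 4 ∂μ + ∫⁻ x in B, α x ^ 2 ∂μ :=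
      lintegral_add_left' (hu.pow_const 4).restrict _
    _ ≤ K * V + V := add_le_add hu4 ((setLIntegral_le_lintegral _ _).trans hα)
    _ = _ := by ring
  calc ∫⁻ x in B, (u x * localMaximal μ α x + localMaximal μ (fun y => u y * α y) x) ∂μ
      ≤ ∫⁻ x in B, (u x ^ 4 + H₁ x + H₂ x) ∂μ := by
        refine lintegral_mono fun x => add_le_add ?_ ?_
        · exact (mul_le_pow_four_add_rpow _ _).trans (add_le_add_right (hle₁ x) _)
        · simpa using hle₂ x
    _ = ∫⁻ x in B, u x ^ 4 ∂μ + ∫⁻ x in B, H₁ x ∂μ + ∫⁻ x in B, H₂ x ∂μ := by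
        rw [lintegral_add_right _ hm₂, lintegral_add_right _ hm₁]
    _ ≤ K * V + (2 ^ Module.finrank ℝ E * V + C₁ * V) +
          (2 ^ Module.finrank ℝ E * V + C₂ * ((K + 1) * V)) := by
        rw [hB] at hint₁ hint₂
        refine add_le_add (add_le_add hu4 (hint₁.trans ?_)) (hint₂.trans ?_)
        · simp only [ENNReal.rpow_ofNat]
          gcongr
        · gcongr
    _ = _ := by push_cast; ring

end Estimates

section TestFunctions

variable {𝕜 : Type*} [RCLike 𝕜] {n : ℕ}

lemma translate_mem_testFunctions {x : EuclideanSpace ℝ (Fin n)}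
    {φ : EuclideanSpace ℝ (Fin n) → 𝕜} (hφ : φ ∈ testFunctions 𝕜 x)
    (v : EuclideanSpace ℝ (Fin n)) : (fun y => φ (y + v)) ∈ testFunctions 𝕜 (x - v) := by
  obtain ⟨hc, t, ht, ht1, hs, hb, hd⟩ := hφ
  have hvol : volume.real (ball (x - v) t) = volume.real (ball x t) := by
    rw [Measure.addHaar_real_ball_center, Measure.addHaar_real_ball_center volume x]
  refine ⟨hc.comp (contDiff_id.add contDiff_const), t, ht, ht1, ?_, ?_, ?_⟩
  · intro y hy
    have h1 : tsupport (φ ∘ Homeomorph.addRight v) = Homeomorph.addRight v ⁻¹' tsupport φ :=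
      tsupport_comp_eq_preimage φ (Homeomorph.addRight v)
    have h2 : y + v ∈ tsupport φ := by
      have : y ∈ tsupport (φ ∘ Homeomorph.addRight v) := hy
      rw [h1] at this
      exact this
    have h3 := hs h2
    rw [mem_ball, dist_eq_norm] at h3 ⊢
    rwa [sub_sub_eq_add_sub]
  · intro y
    rw [hvol]; exact hb _
  · intro y
    rw [hvol, fderiv_comp_add_right]; exact hd _

lemma grandMaximal_eq_iSup_translate (f : EuclideanSpace ℝ (Fin n) → 𝕜)
    (x : EuclideanSpace ℝ (Fin n)) :
    grandMaximal f x = ⨆ φ ∈ testFunctions 𝕜 (0 : EuclideanSpace ℝ (Fin n)),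
      ‖∫ y, f y * φ (y - x)‖ₑ := by
  apply le_antisymm
  · refine iSup₂_le fun φ hφ => ?_
    have h := translate_mem_testFunctions hφ x
    rw [sub_self] at h
    refine le_trans (le_of_eq ?_) (le_iSup₂ (fun y => φ (y + x)) h)
    simp
  · refine iSup₂_le fun φ hφ => ?_
    have h := translate_mem_testFunctions hφ (-x)
    rw [zero_sub, neg_neg] at h
    refine le_trans (le_of_eq ?_) (le_iSup₂ (fun y => φ (y + -x)) h)
    simp [sub_eq_add_neg]

lemma continuous_integral_mul_translate {f : EuclideanSpace ℝ (Fin n) → 𝕜}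
    (hf : Integrable f) {x : EuclideanSpace ℝ (Fin n)} {φ : EuclideanSpace ℝ (Fin n) → 𝕜}
    (hφ : φ ∈ testFunctions 𝕜 x) :
    Continuous fun x : EuclideanSpace ℝ (Fin n) => ∫ y, f y * φ (y - x) := by
  obtain ⟨hc, t, ht, ht1, hs, hb, hd⟩ := hφ
  have hcont := hc.continuous
  refine continuous_of_dominated (bound := fun y => ‖f y‖ * (volume.real (ball x t))⁻¹)
    (fun z => hf.aestronglyMeasurable.mul (by fun_prop)) (fun z => .of_forall fun y => ?_)
    (hf.norm.mul_const _) (.of_forall fun y => by fun_prop)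
  rw [norm_mul]
  gcongr
  exact hb _

lemma integrable_mul_testFunction {f : EuclideanSpace ℝ (Fin n) → 𝕜}
    (hf : Integrable f) {x : EuclideanSpace ℝ (Fin n)} {φ : EuclideanSpace ℝ (Fin n) → 𝕜}
    (hφ : φ ∈ testFunctions 𝕜 x) : Integrable fun y => f y * φ y := by
  obtain ⟨hc, t, ht, ht1, hs, hb, hd⟩ := hφ
  exact hf.mul_bdd hc.continuous.aestronglyMeasurable (.of_forall hb)

lemma aemeasurable_commutatorMaximal {b a : EuclideanSpace ℝ (Fin n) → 𝕜}
    (hb : AEStronglyMeasurable b) (ha : Integrable a) (hba : Integrable fun y => b y * a y) :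
    AEMeasurable (commutatorMaximal b a) volume := by
  let Ψ : EuclideanSpace ℝ (Fin n) × 𝕜 → ℝ≥0∞ := fun p =>
    ⨆ φ ∈ testFunctions 𝕜 (0 : EuclideanSpace ℝ (Fin n)),
      ‖p.2 * (∫ y, a y * φ (y - p.1)) - ∫ y, b y * a y * φ (y - p.1)‖ₑ
  have hΨ : LowerSemicontinuous Ψ := by
    refine lowerSemicontinuous_biSup fun φ hφ => Continuous.lowerSemicontinuous ?_
    have h1 := continuous_integral_mul_translate ha hφ
    have h2 := continuous_integral_mul_translate hba hφ
    exact ((continuous_snd.mul (h1.comp continuous_fst)).sub (h2.comp continuous_fst)).enorm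
  have heq : commutatorMaximal b a = fun x => Ψ (x, b x) := by
    funext x
    rw [commutatorMaximal, grandMaximal_eq_iSup_translate]
    refine iSup_congr fun φ => iSup_congr fun hφ => ?_
    have hφ' := translate_mem_testFunctions hφ (-x)
    simp only [← sub_eq_add_neg] at hφ'
    congr 1
    rw [← integral_const_mul, ← integral_sub ((integrable_mul_testFunction ha hφ').const_mul _)
      (integrable_mul_testFunction hba hφ')]
    congr 1 with y
    ring
  rw [heq]
  exact hΨ.measurable.comp_aemeasurable (aemeasurable_id.prodMk hb.aemeasurable)

lemma enorm_integral_le_grandMaximal (f : EuclideanSpace ℝ (Fin n) → 𝕜)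
    {x : EuclideanSpace ℝ (Fin n)} {φ : EuclideanSpace ℝ (Fin n) → 𝕜}
    (hφ : φ ∈ testFunctions 𝕜 x) : ‖∫ y, f y * φ y‖ₑ ≤ grandMaximal f x :=
  le_iSup₂ (f := fun (φ : EuclideanSpace ℝ (Fin n) → 𝕜) (_ : φ ∈ testFunctions 𝕜 x) =>
    ‖∫ y, f y * φ y‖ₑ) φ hφ

lemma grandMaximal_le_localMaximal (f : EuclideanSpace ℝ (Fin n) → 𝕜)
    (x : EuclideanSpace ℝ (Fin n)) :
    grandMaximal f x ≤ localMaximal volume (fun y => ‖f y‖ₑ) x := by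
  refine iSup₂_le fun φ hφ => ?_
  obtain ⟨hc, t, ht, ht1, hs, hb, hd⟩ := hφ
  have hpos : 0 < volume.real (ball x t) := ENNReal.toReal_pos (measure_ball_pos volume x ht).ne' measure_ball_lt_top.ne
  have hb' : ∀ y, ‖φ y‖ₑ ≤ (volume (ball x t))⁻¹ := fun y => by
    rw [← ofReal_norm, ← ofReal_measureReal measure_ball_lt_top.ne,
      ← ENNReal.ofReal_inv_of_pos hpos]
    exact ENNReal.ofReal_le_ofReal (hb y)
  refine le_trans ?_ (le_iSup_of_le t (le_iSup_of_le ht (le_iSup_of_le ht1 le_rfl)))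
  calc ‖∫ y, f y * φ y‖ₑ ≤ ∫⁻ y, ‖f y * φ y‖ₑ := enorm_integral_le_lintegral_enorm _
    _ = ∫⁻ y in ball x t, ‖f y * φ y‖ₑ :=
      lintegral_eq_setLIntegral_of_ae measurableSet_ball (.of_forall fun y hy => by
        rw [image_eq_zero_of_notMem_tsupport fun h => hy (hs h)]; simp)
    _ ≤ ∫⁻ y in ball x t, ‖f y‖ₑ * (volume (ball x t))⁻¹ := lintegral_mono fun y => by
        rw [enorm_mul]
        gcongr
        exact hb' y
    _ = _ := by
      rw [lintegral_mul_const' _ _ (ENNReal.inv_ne_top.2 (measure_ball_pos volume x ht).ne'),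
        div_eq_mul_inv]

lemma commutatorMaximal_le {b a : EuclideanSpace ℝ (Fin n) → 𝕜} (c : 𝕜) (ha : Integrable a)
    (hba : Integrable fun y => a y * (b y - c)) (x : EuclideanSpace ℝ (Fin n)) :
    commutatorMaximal b a x ≤
      ‖b x - c‖ₑ * grandMaximal a x + grandMaximal (fun y => a y * (b y - c)) x := by
  refine iSup₂_le fun φ hφ => ?_
  have h : ∫ y, (b x * a y - b y * a y) * φ y =
      (b x - c) * (∫ y, a y * φ y) - ∫ y, a y * (b y - c) * φ y := by
    rw [← integral_const_mul, ← integral_sub ((integrable_mul_testFunction ha hφ).const_mul _)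
      (integrable_mul_testFunction hba hφ)]
    congr 1 with y
    ring
  rw [h]
  refine enorm_sub_le.trans (add_le_add ?_ ?_)
  · rw [enorm_mul]
    exact mul_le_mul_right (enorm_integral_le_grandMaximal a hφ) _
  · exact enorm_integral_le_grandMaximal (fun y => a y * (b y - c)) hφ

lemma integral_mul_testFunction_eq_zero {f φ : EuclideanSpace ℝ (Fin n) → 𝕜}
    {x x₀ : EuclideanSpace ℝ (Fin n)} {r t : ℝ} (hsupp : ∀ᵐ y, y ∉ ball x₀ r → f y = 0)
    (hs : tsupport φ ⊆ ball x t) (h : r + t ≤ dist x x₀) : ∫ y, f y * φ y = 0 := by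
  rw [← integral_zero (EuclideanSpace ℝ (Fin n)) 𝕜]
  refine integral_congr_ae (hsupp.mono fun y hy => ?_)
  by_cases hyB : y ∈ ball x₀ r
  · have : y ∉ tsupport φ := fun hyφ =>
      (ball_disjoint_ball (by rwa [add_comm] : t + r ≤ dist x x₀)).le_bot ⟨hs hyφ, hyB⟩
    simp [image_eq_zero_of_notMem_tsupport this]
  · simp [hy hyB]

lemma grandMaximal_eq_zero_of_far {f : EuclideanSpace ℝ (Fin n) → 𝕜}
    {x x₀ : EuclideanSpace ℝ (Fin n)} {r : ℝ} (hsupp : ∀ᵐ y, y ∉ ball x₀ r → f y = 0)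
    (h : r + 1 ≤ dist x x₀) : grandMaximal f x = 0 := by
  refine le_antisymm (iSup₂_le fun φ hφ => ?_) zero_le
  obtain ⟨hc, t, ht, ht1, hs, hb, hd⟩ := hφ
  rw [integral_mul_testFunction_eq_zero hsupp hs (by linarith)]
  simp

/-- Away from the support of `f`, the cancellation of `f` makes the grand maximal function
small. -/
lemma grandMaximal_le_of_far {f : EuclideanSpace ℝ (Fin n) → 𝕜} (hf : Integrable f)
    {x x₀ : EuclideanSpace ℝ (Fin n)} {r R : ℝ} (hsupp : ∀ᵐ y, y ∉ ball x₀ r → f y = 0)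
    (hr : 0 < r) (hR : 0 < R) (h : R ≤ dist x x₀ - r) :
    grandMaximal f x ≤
      (‖∫ y, f y‖ₑ + ENNReal.ofReal (r / R) * ∫⁻ y, ‖f y‖ₑ) / volume (ball x₀ R) := by
  refine iSup₂_le fun φ hφ => ?_
  have hint := integrable_mul_testFunction hf hφ
  obtain ⟨hc, t, ht, ht1, hs, hb, hd⟩ := hφ
  rcases le_or_gt (r + t) (dist x x₀) with hfar | hnear
  · rw [integral_mul_testFunction_eq_zero hsupp hs hfar]
    simp
  have hposR : 0 < volume.real (ball x₀ R) := ENNReal.toReal_pos (measure_ball_pos volume x₀ hR).ne' measure_ball_lt_top.ne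
  have hvol : volume.real (ball x₀ R) ≤ volume.real (ball x t) := by
    rw [Measure.addHaar_real_ball_center, Measure.addHaar_real_ball_center volume x]
    exact measureReal_mono (ball_subset_ball (by linarith)) measure_ball_lt_top.ne
  have hinv : ENNReal.ofReal (volume.real (ball x₀ R))⁻¹ = (volume (ball x₀ R))⁻¹ := by
    rw [ENNReal.ofReal_inv_of_pos hposR, ofReal_measureReal measure_ball_lt_top.ne]
  have hφ0 : ‖φ x₀‖ₑ ≤ (volume (ball x₀ R))⁻¹ := by
    rw [← ofReal_norm, ← hinv]
    exact ENNReal.ofReal_le_ofReal ((hb x₀).trans (by gcongr))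
  have hdiff : ∀ y ∈ ball x₀ r,
      ‖φ y - φ x₀‖ₑ ≤ ENNReal.ofReal (r / R) * (volume (ball x₀ R))⁻¹ := by
    intro y hy
    rw [← ofReal_norm, ← hinv, ← ENNReal.ofReal_mul (by positivity)]
    refine ENNReal.ofReal_le_ofReal ?_
    calc ‖φ y - φ x₀‖ ≤ (t * volume.real (ball x t))⁻¹ * ‖y - x₀‖ :=
          convex_univ.norm_image_sub_le_of_norm_fderiv_le
            (fun z _ => (hc.differentiable one_ne_zero) z) (fun z _ => hd z) (mem_univ _) (mem_univ _)
      _ ≤ (R * volume.real (ball x₀ R))⁻¹ * r := by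
          have : ‖y - x₀‖ ≤ r := by rw [← dist_eq_norm]; exact (mem_ball.1 hy).le
          gcongr
          linarith
      _ = _ := by rw [mul_inv]; ring
  have hsplit : ∫ y, f y * φ y = (∫ y, f y) * φ x₀ + ∫ y, f y * (φ y - φ x₀) := by
    have : ∫ y, f y * (φ y - φ x₀) = (∫ y, f y * φ y) - (∫ y, f y) * φ x₀ := by
      rw [← integral_mul_const, ← integral_sub hint (hf.mul_const _)]
      congr 1 with y
      ring
    rw [this]; ring
  rw [hsplit]
  refine (enorm_add_le _ _).trans ?_
  rw [ENNReal.add_div, div_eq_mul_inv, div_eq_mul_inv]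
  refine add_le_add ?_ ?_
  · rw [enorm_mul]
    gcongr
  · calc ‖∫ y, f y * (φ y - φ x₀)‖ₑ ≤ ∫⁻ y, ‖f y * (φ y - φ x₀)‖ₑ :=
          enorm_integral_le_lintegral_enorm _
      _ ≤ ∫⁻ y, ‖f y‖ₑ * (ENNReal.ofReal (r / R) * (volume (ball x₀ R))⁻¹) := by
          refine lintegral_mono_ae (hsupp.mono fun y hy => ?_)
          rw [enorm_mul]
          by_cases hyB : y ∈ ball x₀ r
          · gcongr
            exact hdiff y hyB
          · simp [hy hyB]
      _ = _ := by
          rw [lintegral_mul_const' _ _ (ENNReal.mul_ne_top ENNReal.ofReal_ne_top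
            (ENNReal.inv_ne_top.2 (measure_ball_pos volume x₀ hR).ne'))]
          ring

end TestFunctions

section Bmo

variable {𝕜 : Type*} [RCLike 𝕜] {n : ℕ} {b : EuclideanSpace ℝ (Fin n) → 𝕜} {N : ℝ≥0}

lemma hasOscillationLE_of_bmoNorm_le (h : bmoNorm b ≤ N) :
    HasOscillationLE volume b (ballConst b) N := by
  intro x r hr
  have h1 : ⨍⁻ y in ball x r, ‖b y - ballConst b x r‖ₑ ∂volume ≤ N := by
    simp only [bmoNorm, iSup_le_iff] at h
    exact h x r hr
  rw [setLAverage_eq] at h1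
  exact (ENNReal.div_le_iff (measure_ball_pos volume x hr).ne' measure_ball_lt_top.ne).1 h1

lemma mul_sq_le (x y : ℝ≥0∞) : x * y ≤ x ^ 2 + y ^ 2 := by
  rcases le_total x y with h | h
  · refine le_trans ?_ le_add_self
    rw [sq]; gcongr
  · refine le_trans ?_ le_self_add
    rw [sq]; gcongr

lemma bmoNormExp_two_le (hN : N ≠ 0) {C : ℝ≥0}
    (hC : ∀ (x : EuclideanSpace ℝ (Fin n)) (r : ℝ), 0 < r →
      ∫⁻ y in ball x r, ‖b y - ballConst b x r‖ₑ ^ 4 ≤ C * N ^ 4 * volume (ball x r)) :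
    bmoNormExp 2 b ≤ (1 + C) * N := by
  have hN' : (N : ℝ≥0∞) ^ 2 ≠ 0 := by
    have : (N : ℝ≥0∞) ≠ 0 := by exact_mod_cast hN
    positivity
  have key : (⨆ (x₀ : EuclideanSpace ℝ (Fin n)) (r : ℝ) (_ : 0 < r),
      ⨍⁻ y in ball x₀ r, ‖b y - ballConst b x₀ r‖ₑ ^ (2 : ℝ) ∂volume) ≤ ((1 + C) * N) ^ (2 : ℝ) := by
    refine iSup_le fun x => iSup_le fun r => iSup_le fun hr => ?_
    rw [setLAverage_eq]
    refine ENNReal.div_le_of_le_mul ?_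
    rw [← ENNReal.mul_le_mul_iff_right hN' (by finiteness), ← lintegral_const_mul' _ _ (by finiteness)]
    calc ∫⁻ y in ball x r, N ^ 2 * ‖b y - ballConst b x r‖ₑ ^ (2 : ℝ)
        ≤ ∫⁻ y in ball x r, (N ^ 4 + ‖b y - ballConst b x r‖ₑ ^ 4) := lintegral_mono fun y => by
          rw [ENNReal.rpow_ofNat]
          refine (mul_sq_le _ _).trans (le_of_eq ?_)
          ring
      _ = N ^ 4 * volume (ball x r) + ∫⁻ y in ball x r, ‖b y - ballConst b x r‖ₑ ^ 4 := by
          rw [lintegral_add_left measurable_const, setLIntegral_const]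
      _ ≤ N ^ 4 * volume (ball x r) + C * N ^ 4 * volume (ball x r) := by
          gcongr
          exact hC x r hr
      _ = (1 + C) * (N ^ 4 * volume (ball x r)) := by ring
      _ ≤ (1 + C) * ((1 + C) * (N ^ 4 * volume (ball x r))) := by
          refine mul_le_mul_right ?_ _
          rw [add_mul, one_mul]
          exact le_self_add
      _ = _ := by rw [ENNReal.rpow_ofNat]; ring
  calc bmoNormExp 2 b ≤ (((1 + C) * N) ^ (2 : ℝ)) ^ (1 / 2 : ℝ) :=
        ENNReal.rpow_le_rpow key (by norm_num)
    _ = _ := by rw [← ENNReal.rpow_mul]; norm_num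

end Bmo

/-- Only logarithmically many dyadic annuli around a small ball meet the unit neighbourhood of
the ball. -/
lemma nat_add_one_le_four_mul_log {r : ℝ} (hr : 0 < r) {i : ℕ} (h : 2 ^ (i + 1) * r < r + 1) :
    (i + 1 : ℝ) ≤ 4 * Real.log (1 + r⁻¹) := by
  have h2 : (2 : ℝ) ≤ 2 ^ (i + 1) := le_self_pow₀ one_le_two (by omega)
  have hr1 : r < 1 := by nlinarith
  have hinv : 1 < r⁻¹ := (one_lt_inv₀ hr).2 hr1
  have hpow : (2 : ℝ) ^ (i + 1) ≤ (1 + r⁻¹) ^ 2 := by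
    have h3 : (2 : ℝ) ^ (i + 1) ≤ 2 * r⁻¹ := by
      rw [← div_eq_mul_inv, le_div_iff₀ hr]; linarith
    nlinarith
  have hlog := Real.log_le_log (by positivity) hpow
  rw [Real.log_pow, Real.log_pow] at hlog
  have := Real.log_two_gt_d9
  push_cast at hlog
  have hi : (0 : ℝ) ≤ i := i.cast_nonneg
  nlinarith

lemma exists_annulus {X : Type*} [PseudoMetricSpace X] {x x₀ : X} {r : ℝ} (hr : 0 < r)
    (h : x ∉ ball x₀ (2 * r)) :
    ∃ i : ℕ, 2 ^ (i + 1) * r ≤ dist x x₀ ∧ dist x x₀ < 2 ^ (i + 2) * r := by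
  rw [mem_ball, not_lt] at h
  obtain ⟨i, h1, h2⟩ := exists_nat_pow_near (x := dist x x₀ / (2 * r)) (y := 2)
    ((one_le_div (by positivity)).2 h) one_lt_two
  rw [le_div_iff₀ (by positivity)] at h1
  rw [div_lt_iff₀ (by positivity)] at h2
  exact ⟨i, by rw [pow_succ]; linarith, by rw [pow_succ]; linarith⟩

section Far

variable {𝕜 : Type*} [RCLike 𝕜] {n : ℕ}

/-- The contribution of one dyadic annulus, before summation. -/
lemma lintegral_annulus_le {b a : EuclideanSpace ℝ (Fin n) → 𝕜}
    {c : EuclideanSpace ℝ (Fin n) → ℝ → 𝕜} {N : ℝ≥0} {x₀ : EuclideanSpace ℝ (Fin n)} {r : ℝ}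
    {K : ℝ≥0} {l : ℝ≥0∞}
    (h : HasOscillationLE volume b c N) (hb : AEStronglyMeasurable b) (hr : 0 < r)
    (ha : Integrable a) (hba : Integrable fun y => a y * (b y - c x₀ r))
    (hsupp : ∀ᵐ y, y ∉ ball x₀ r → a y = 0) (hl : l ≠ ∞)
    (ha1 : ∫⁻ y, ‖a y‖ₑ ≤ 2) (hba1 : ∫⁻ y, ‖a y * (b y - c x₀ r)‖ₑ ≤ K * N)
    (ha0 : ‖∫ y, a y‖ₑ ≤ l ^ 2) (hba0 : ‖∫ y, a y * (b y - c x₀ r)‖ₑ ≤ K * N * l) (i : ℕ) :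
    ∫⁻ x in {x | 2 ^ (i + 1) * r ≤ dist x x₀ ∧ dist x x₀ < 2 ^ (i + 2) * r},
        commutatorMaximal b a x ≤
      4 ^ Module.finrank ℝ (EuclideanSpace ℝ (Fin n)) * N *
        ((1 + (i + 2 : ℕ) * (1 + 2 ^ Module.finrank ℝ (EuclideanSpace ℝ (Fin n)))) *
          (l ^ 2 + 2 * 2⁻¹ ^ i) + K * (l + 2⁻¹ ^ i)) := by
  have hsupp' : ∀ᵐ y, y ∉ ball x₀ r → a y * (b y - c x₀ r) = 0 :=
    hsupp.mono fun y hy hyB => by rw [hy hyB, zero_mul]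
  set d := Module.finrank ℝ (EuclideanSpace ℝ (Fin n))
  set A : Set (EuclideanSpace ℝ (Fin n)) :=
    {x | 2 ^ (i + 1) * r ≤ dist x x₀ ∧ dist x x₀ < 2 ^ (i + 2) * r}
  have hi0 : 0 < 2 ^ i * r := by positivity
  set V := volume (ball x₀ (2 ^ i * r))
  have hV0 : V ≠ 0 := (measure_ball_pos volume x₀ hi0).ne'
  have hVt : V ≠ ∞ := measure_ball_lt_top.ne
  have hV4 : volume (ball x₀ (2 ^ (i + 2) * r)) = 4 ^ d * V := by
    rw [show (2 : ℝ) ^ (i + 2) * r = 4 * (2 ^ i * r) by ring,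
      measure_ball_mul volume x₀ x₀ four_pos, ENNReal.ofReal_ofNat]
  have hri : ENNReal.ofReal (r / (2 ^ i * r)) = 2⁻¹ ^ i := by
    rw [show r / (2 ^ i * r) = (2⁻¹ : ℝ) ^ i by rw [inv_pow]; field_simp,
      ENNReal.ofReal_pow (by positivity), ENNReal.ofReal_inv_of_pos two_pos, ENNReal.ofReal_ofNat]
  have hk1 : (l ^ 2 + 2⁻¹ ^ i * 2) / V ≠ ∞ := ENNReal.div_ne_top (by finiteness) hV0
  have hAm : MeasurableSet A :=
    (measurableSet_le measurable_const (measurable_id.dist measurable_const)).inter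
      (measurableSet_lt (measurable_id.dist measurable_const) measurable_const)
  calc ∫⁻ x in A, commutatorMaximal b a x
      ≤ ∫⁻ x in A, (‖b x - c x₀ r‖ₑ * ((l ^ 2 + 2⁻¹ ^ i * 2) / V) +
          (K * N * l + 2⁻¹ ^ i * (K * N)) / V) := by
        refine setLIntegral_mono' hAm fun x hx => ?_
        have hR : 2 ^ i * r ≤ dist x x₀ - r := by
          have h1 : (1 : ℝ) ≤ 2 ^ i := one_le_pow₀ one_le_two
          have h2 := hx.1
          rw [pow_succ] at h2
          nlinarith
        refine (commutatorMaximal_le (c x₀ r) ha hba x).trans (add_le_add ?_ ?_)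
        · refine mul_le_mul_right ?_ _
          refine (grandMaximal_le_of_far ha hsupp hr hi0 hR).trans ?_
          rw [hri]
          gcongr
        · refine (grandMaximal_le_of_far hba hsupp' hr hi0 hR).trans ?_
          rw [hri]
          gcongr
    _ ≤ ∫⁻ x in ball x₀ (2 ^ (i + 2) * r), (‖b x - c x₀ r‖ₑ * ((l ^ 2 + 2⁻¹ ^ i * 2) / V) +
          (K * N * l + 2⁻¹ ^ i * (K * N)) / V) := lintegral_mono_set fun x hx => hx.2
    _ = (∫⁻ x in ball x₀ (2 ^ (i + 2) * r), ‖b x - c x₀ r‖ₑ) * ((l ^ 2 + 2⁻¹ ^ i * 2) / V) +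
          (K * N * l + 2⁻¹ ^ i * (K * N)) / V * (4 ^ d * V) := by
        rw [lintegral_add_right _ measurable_const, setLIntegral_const, hV4,
          lintegral_mul_const' _ _ hk1]
    _ ≤ (1 + (i + 2 : ℕ) * (1 + 2 ^ d)) * N * (4 ^ d * V) * ((l ^ 2 + 2⁻¹ ^ i * 2) / V) +
          (K * N * l + 2⁻¹ ^ i * (K * N)) / V * (4 ^ d * V) := by
        gcongr
        rw [← hV4]
        exact h.lintegral_two_pow_le hb x₀ hr (i + 2)
    _ = (V / V) * (4 ^ d * N * ((1 + (i + 2 : ℕ) * (1 + 2 ^ d)) *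
          (l ^ 2 + 2 * 2⁻¹ ^ i) + K * (l + 2⁻¹ ^ i))) := by
        simp only [div_eq_mul_inv]
        ring
    _ = _ := by rw [ENNReal.div_self hV0 hVt, one_mul]

lemma lintegral_annulus_eq_zero {b a : EuclideanSpace ℝ (Fin n) → 𝕜}
    {x₀ : EuclideanSpace ℝ (Fin n)} {r ρ R : ℝ} (hsupp : ∀ᵐ y, y ∉ ball x₀ r → a y = 0)
    (h : r + 1 ≤ ρ) :
    ∫⁻ x in {x | ρ ≤ dist x x₀ ∧ dist x x₀ < R}, commutatorMaximal b a x = 0 := by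
  have hAm : MeasurableSet {x : EuclideanSpace ℝ (Fin n) | ρ ≤ dist x x₀ ∧ dist x x₀ < R} :=
    (measurableSet_le measurable_const (measurable_id.dist measurable_const)).inter
      (measurableSet_lt (measurable_id.dist measurable_const) measurable_const)
  rw [setLIntegral_congr_fun hAm (g := fun _ => 0), lintegral_zero]
  intro x hx
  exact grandMaximal_eq_zero_of_far (hsupp.mono fun y hy hyB => by rw [hy hyB]; simp)
    (h.trans hx.1)

/-- The part of the estimate away from the ball supporting the atom. -/
lemma exists_lintegral_far_le (𝕜 : Type*) [RCLike 𝕜] (n : ℕ) (K : ℝ≥0) :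
    ∃ C : ℝ≥0, ∀ (b a : EuclideanSpace ℝ (Fin n) → 𝕜) (c : EuclideanSpace ℝ (Fin n) → ℝ → 𝕜)
      (N : ℝ≥0) (x₀ : EuclideanSpace ℝ (Fin n)) (r : ℝ) (l : ℝ≥0∞),
      HasOscillationLE volume b c N → AEStronglyMeasurable b → 0 < r →
      Integrable a → Integrable (fun y => a y * (b y - c x₀ r)) →
      (∀ᵐ y, y ∉ ball x₀ r → a y = 0) → l = ENNReal.ofReal (1 / Real.log (1 + r⁻¹)) →
      ∫⁻ y, ‖a y‖ₑ ≤ 2 → ∫⁻ y, ‖a y * (b y - c x₀ r)‖ₑ ≤ K * N →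
      ‖∫ y, a y‖ₑ ≤ l ^ 2 → ‖∫ y, a y * (b y - c x₀ r)‖ₑ ≤ K * N * l →
      ∫⁻ x in (ball x₀ (2 * r))ᶜ, commutatorMaximal b a x ≤ C * N := by
  set d := Module.finrank ℝ (EuclideanSpace ℝ (Fin n))
  have hsum := tsum_pow_mul_inv_two_pow_ne_top 1
  set T := ∑' k : ℕ, (((k + 1 : ℕ) : ℝ≥0∞)) ^ 1 * 2⁻¹ ^ k
  let Q : ℝ≥0∞ := 4 ^ d * (4 * (3 + 2 * 2 ^ d) + K)
  have hQ : Q * (4 + T) ≠ ∞ := ENNReal.mul_ne_top (by finiteness) (by finiteness)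
  refine ⟨(Q * (4 + T)).toNNReal, ?_⟩
  intro b a c N x₀ r l h hb hr ha hba hsupp hl ha1 hba1 ha0 hba0
  rw [ENNReal.coe_toNNReal hQ]
  have hlpos : 0 < Real.log (1 + r⁻¹) := Real.log_pos (by linarith [inv_pos.2 hr])
  have hlt : l ≠ ∞ := hl ▸ ENNReal.ofReal_ne_top
  have hcancel : ∀ t : ℝ, 0 ≤ t → t ≤ 4 * Real.log (1 + r⁻¹) → ENNReal.ofReal t * l ≤ 4 := by
    intro t ht0 ht
    rw [hl, ← ENNReal.ofReal_mul ht0, ← ENNReal.ofReal_ofNat]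
    refine ENNReal.ofReal_le_ofReal ?_
    rw [mul_one_div, div_le_iff₀ hlpos]
    exact ht
  set M := ⌊4 * Real.log (1 + r⁻¹)⌋₊
  have hterm : ∀ i : ℕ,
      ∫⁻ x in {x | 2 ^ (i + 1) * r ≤ dist x x₀ ∧ dist x x₀ < 2 ^ (i + 2) * r},
        commutatorMaximal b a x ≤
      Q * N * ((if i < M then l else 0) + ((i + 1 : ℕ) : ℝ≥0∞) ^ 1 * 2⁻¹ ^ i) := by
    intro i
    rcases le_or_gt (r + 1) (2 ^ (i + 1) * r) with hfar | hnear
    · rw [lintegral_annulus_eq_zero hsupp hfar]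
      exact zero_le
    have hi := nat_add_one_le_four_mul_log hr hnear
    have hiM : i < M := Nat.lt_of_succ_le (Nat.le_floor (by push_cast; exact hi))
    have hil : ((i + 1 : ℕ) : ℝ≥0∞) * l ≤ 4 := by
      rw [← ENNReal.ofReal_natCast]
      exact hcancel _ (by positivity) (by push_cast; exact hi)
    refine (lintegral_annulus_le h hb hr ha hba hsupp hlt ha1 hba1 ha0 hba0 i).trans ?_
    rw [if_pos hiM, pow_one]
    set k : ℝ≥0∞ := ((i + 1 : ℕ) : ℝ≥0∞) with hk
    have hk1 : 1 ≤ k := by rw [hk]; exact_mod_cast Nat.succ_le_succ (Nat.zero_le i)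
    have hk2 : ((i + 2 : ℕ) : ℝ≥0∞) = k + 1 := by rw [hk]; push_cast; ring
    set D : ℝ≥0∞ := 2 ^ d
    set q : ℝ≥0∞ := 2⁻¹ ^ i
    have h1 : 1 + (k + 1) * (1 + D) ≤ k * (3 + 2 * D) := calc
      1 + (k + 1) * (1 + D) = k * (1 + D) + 1 * (2 + D) := by ring
      _ ≤ k * (1 + D) + k * (2 + D) := by gcongr
      _ = _ := by ring
    rw [hk2]
    calc 4 ^ d * N * ((1 + (k + 1) * (1 + D)) * (l ^ 2 + 2 * q) + K * (l + q))
        ≤ 4 ^ d * N * (k * (3 + 2 * D) * (l ^ 2 + 2 * q) + K * (l + k * q)) := by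
          have h2 : q ≤ k * q := le_mul_of_one_le_left (by positivity) hk1
          gcongr
      _ = 4 ^ d * N * ((3 + 2 * D) * (k * l * l + 2 * (k * q)) + K * (l + k * q)) := by ring
      _ ≤ 4 ^ d * N * ((3 + 2 * D) * (4 * l + 4 * (k * q)) + K * (l + k * q)) := by
          gcongr
          norm_num
      _ = _ := by simp only [Q]; ring
  calc ∫⁻ x in (ball x₀ (2 * r))ᶜ, commutatorMaximal b a x
      ≤ ∫⁻ x in ⋃ i : ℕ, {x | 2 ^ (i + 1) * r ≤ dist x x₀ ∧ dist x x₀ < 2 ^ (i + 2) * r},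
          commutatorMaximal b a x :=
        lintegral_mono_set fun x hx => mem_iUnion.2 (exists_annulus hr hx)
    _ ≤ ∑' i : ℕ, ∫⁻ x in {x | 2 ^ (i + 1) * r ≤ dist x x₀ ∧ dist x x₀ < 2 ^ (i + 2) * r},
          commutatorMaximal b a x := lintegral_iUnion_le _ _
    _ ≤ ∑' i : ℕ, Q * N * ((if i < M then l else 0) + ((i + 1 : ℕ) : ℝ≥0∞) ^ 1 * 2⁻¹ ^ i) :=
        ENNReal.tsum_le_tsum hterm
    _ = Q * N * ((∑' i : ℕ, if i < M then l else 0) + T) := by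
        rw [ENNReal.tsum_mul_left, ENNReal.tsum_add]
    _ ≤ Q * N * (4 + T) := by
        gcongr
        rw [tsum_eq_sum (s := Finset.range M) fun i hi => if_neg (by simpa using hi),
          Finset.sum_congr rfl fun i hi => if_pos (Finset.mem_range.1 hi), Finset.sum_const,
          Finset.card_range, nsmul_eq_mul, ← ENNReal.ofReal_natCast]
        exact hcancel _ (by positivity) (Nat.floor_le (by positivity))
    _ = _ := by ring

end Far

lemma lintegral_enorm_sq_le_inv {α F : Type*} [MeasurableSpace α] [NormedAddCommGroup F]
    {μ : Measure α} {f : α → F} {V : ℝ≥0∞} (h : eLpNorm f 2 μ ≤ V ^ (-(1 / 2) : ℝ)) :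
    ∫⁻ y, ‖f y‖ₑ ^ 2 ∂μ ≤ V⁻¹ := by
  have h1 : eLpNorm f 2 μ ^ (2 : ℝ) = ∫⁻ y, ‖f y‖ₑ ^ 2 ∂μ := by
    rw [eLpNorm_eq_lintegral_rpow_enorm_toReal two_ne_zero ENNReal.ofNat_ne_top, ← ENNReal.rpow_mul]
    simp
  rw [← h1]
  refine (ENNReal.rpow_le_rpow h (by norm_num)).trans (le_of_eq ?_)
  rw [← ENNReal.rpow_mul, ← ENNReal.rpow_neg_one]
  norm_num

lemma le_one_add_sq (x : ℝ≥0∞) : x ≤ 1 + x ^ 2 := by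
  simpa using mul_sq_le 1 x

lemma exists_lintegral_commutatorMaximal_le (𝕜 : Type*) [RCLike 𝕜] (n : ℕ) :
    ∃ C : ℝ≥0, ∀ (b a : EuclideanSpace ℝ (Fin n) → 𝕜) (N : ℝ≥0), N ≠ 0 →
      LocallyIntegrable b volume → bmoNorm b ≤ N → IsApproxAtom b a →
        AEMeasurable (commutatorMaximal b a) volume ∧
        ∫⁻ x, commutatorMaximal b a x ≤ C * N := by
  obtain ⟨C₄, hC₄⟩ := exists_lintegral_pow_four_le (EuclideanSpace ℝ (Fin n)) 𝕜 volume
  set d := Module.finrank ℝ (EuclideanSpace ℝ (Fin n))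
  let K : ℝ≥0 := 16 * (C₄ + (1 + 2 ^ d) ^ 4) * 2 ^ d
  obtain ⟨C₁, hnear⟩ := exists_lintegral_near_le
    (volume : Measure (EuclideanSpace ℝ (Fin n))) K
  obtain ⟨C₂, hfar⟩ := exists_lintegral_far_le 𝕜 n (2 + K + C₄)
  refine ⟨C₁ + C₂, ?_⟩
  intro b a N hN hbl hbN hatom
  obtain ⟨haL2, x₀, r, hr, hsupp, hnorm, hmean, hmeanb⟩ := hatom
  have hbm := hbl.aestronglyMeasurable
  have ham := haL2.1
  have hosc := hasOscillationLE_of_bmoNorm_le hbN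
  have hL4 := hC₄ b (ballConst b) N hN hbl hosc
  have hL4' := hosc.lintegral_two_mul_pow_four_le hbm hL4 x₀ hr
  have hexp := bmoNormExp_two_le hN hL4
  have hN0 : (N : ℝ≥0∞) ≠ 0 := by exact_mod_cast hN
  set c := ballConst b x₀ r with hc
  set V := volume (ball x₀ r)
  have hV0 : V ≠ 0 := (measure_ball_pos volume x₀ hr).ne'
  have hVt : V ≠ ∞ := measure_ball_lt_top.ne
  let u : EuclideanSpace ℝ (Fin n) → ℝ≥0∞ := fun y => (N : ℝ≥0∞)⁻¹ * ‖b y - c‖ₑ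
  let α : EuclideanSpace ℝ (Fin n) → ℝ≥0∞ := fun y => V * ‖a y‖ₑ
  have hum : AEMeasurable u volume := (hbm.sub aestronglyMeasurable_const).enorm.const_mul _
  have hu : ∀ y, ‖b y - c‖ₑ = N * u y := fun y => by
    rw [← mul_assoc, ENNReal.mul_inv_cancel hN0 ENNReal.coe_ne_top, one_mul]
  have hα : ∀ y, ‖a y‖ₑ = V⁻¹ * α y := fun y => by
    rw [← mul_assoc, ENNReal.inv_mul_cancel hV0 hVt, one_mul]
  have huα : ∀ y, ‖a y * (b y - c)‖ₑ = N * V⁻¹ * (u y * α y) := fun y => by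
    rw [enorm_mul, hu, hα]; ring
  have hu4 : ∫⁻ y in ball x₀ (2 * r), u y ^ 4 ≤ K * V := by
    have h4 : (N : ℝ≥0∞) ^ 4 ≠ 0 := by positivity
    rw [← ENNReal.mul_le_mul_iff_right h4 (by finiteness), ← lintegral_const_mul' _ _ (by finiteness)]
    simp only [← mul_pow, ← hu]
    refine hL4'.trans (le_of_eq ?_)
    simp only [K, d]
    push_cast
    ring
  have hα2 : ∫⁻ y, α y ^ 2 ≤ V := by
    simp only [α, mul_pow]
    rw [lintegral_const_mul' _ _ (by finiteness)]
    calc V ^ 2 * ∫⁻ y, ‖a y‖ₑ ^ 2 ≤ V ^ 2 * V⁻¹ :=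
          mul_le_mul_right (lintegral_enorm_sq_le_inv hnorm) _
      _ = V := by rw [sq, mul_assoc, ENNReal.mul_inv_cancel hV0 hVt, mul_one]
  have hαsupp : ∀ᵐ y, y ∉ ball x₀ r → α y = 0 := hsupp.mono fun y hy hyB => by
    simp [α, hy hyB]
  have hα1 : ∫⁻ y, α y ≤ 2 * V := by
    rw [lintegral_eq_setLIntegral_of_ae measurableSet_ball hαsupp]
    calc ∫⁻ y in ball x₀ r, α y ≤ ∫⁻ y in ball x₀ r, (1 + α y ^ 2) :=
          lintegral_mono fun y => le_one_add_sq _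
      _ = V + ∫⁻ y in ball x₀ r, α y ^ 2 := by
          rw [lintegral_add_left measurable_const, setLIntegral_const, one_mul]
      _ ≤ V + V := by
          gcongr
          exact (setLIntegral_le_lintegral _ _).trans hα2
      _ = _ := by ring
  have huα1 : ∫⁻ y, u y * α y ≤ (2 + K) * V := by
    rw [lintegral_eq_setLIntegral_of_ae (f := fun y => u y * α y) measurableSet_ball
      (hαsupp.mono fun y hy hyB => by rw [hy hyB, mul_zero])]
    calc ∫⁻ y in ball x₀ r, u y * α y ≤ ∫⁻ y in ball x₀ r, (1 + u y ^ 4 + α y ^ 2) := by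
          refine lintegral_mono fun y => (mul_sq_le _ _).trans (add_le_add_left ?_ _)
          refine (le_one_add_sq _).trans (le_of_eq ?_)
          ring
      _ = V + (∫⁻ y in ball x₀ r, u y ^ 4) + ∫⁻ y in ball x₀ r, α y ^ 2 := by
          rw [lintegral_add_left' ((hum.pow_const 4).const_add 1).restrict,
            lintegral_add_left measurable_const, setLIntegral_const, one_mul]
      _ ≤ V + K * V + V := by
          gcongr
          · exact (lintegral_mono_set (ball_subset_ball (by linarith))).trans hu4
          · exact (setLIntegral_le_lintegral _ _).trans hα2
      _ = _ := by ring
  have ha1 : ∫⁻ y, ‖a y‖ₑ ≤ 2 := by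
    simp only [hα]
    rw [lintegral_const_mul' _ _ (ENNReal.inv_ne_top.2 hV0)]
    calc V⁻¹ * ∫⁻ y, α y ≤ V⁻¹ * (2 * V) := by gcongr
      _ = 2 * (V⁻¹ * V) := by ring
      _ = 2 := by rw [ENNReal.inv_mul_cancel hV0 hVt, mul_one]
  have hNV : (N : ℝ≥0∞) * V⁻¹ ≠ ∞ := ENNReal.mul_ne_top ENNReal.coe_ne_top (ENNReal.inv_ne_top.2 hV0)
  have hba1 : ∫⁻ y, ‖a y * (b y - c)‖ₑ ≤ (2 + K) * N := by
    simp only [huα]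
    rw [lintegral_const_mul' _ _ hNV]
    calc N * V⁻¹ * ∫⁻ y, u y * α y ≤ N * V⁻¹ * ((2 + K) * V) := by gcongr
      _ = (2 + K) * N * (V⁻¹ * V) := by ring
      _ = (2 + K) * N := by rw [ENNReal.inv_mul_cancel hV0 hVt, mul_one]
  have ha : Integrable a := ⟨ham, lt_of_le_of_lt ha1 (by norm_num)⟩
  have hba : Integrable fun y => a y * (b y - c) :=
    ⟨ham.mul (hbm.sub aestronglyMeasurable_const), lt_of_le_of_lt hba1 (by finiteness)⟩
  have hba' : Integrable fun y => b y * a y :=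
    (hba.add (ha.mul_const c)).congr (.of_forall fun y => by simp only [Pi.add_apply]; ring)
  refine ⟨aemeasurable_commutatorMaximal hbm ha hba', ?_⟩
  have hlpos : 0 < Real.log (1 + r⁻¹) := Real.log_pos (by linarith [inv_pos.2 hr])
  have hnear' : ∫⁻ x in ball x₀ (2 * r), commutatorMaximal b a x ≤ C₁ * N := by
    have hle : ∀ x, commutatorMaximal b a x ≤ N * V⁻¹ *
        (u x * localMaximal volume α x + localMaximal volume (fun y => u y * α y) x) := by
      intro x
      refine (commutatorMaximal_le c ha hba x).trans ?_
      have h1 := grandMaximal_le_localMaximal a x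
      have h2 := grandMaximal_le_localMaximal (fun y => a y * (b y - c)) x
      simp only [hα] at h1
      simp only [huα] at h2
      rw [localMaximal_const_mul _ (ENNReal.inv_ne_top.2 hV0)] at h1
      rw [localMaximal_const_mul _ hNV] at h2
      refine (add_le_add (mul_le_mul_right h1 _) h2).trans (le_of_eq ?_)
      rw [hu]; ring
    calc ∫⁻ x in ball x₀ (2 * r), commutatorMaximal b a x
        ≤ ∫⁻ x in ball x₀ (2 * r), N * V⁻¹ *
        (u x * localMaximal volume α x + localMaximal volume (fun y => u y * α y) x) :=
          lintegral_mono hle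
      _ = N * V⁻¹ * ∫⁻ x in ball x₀ (2 * r),
        (u x * localMaximal volume α x + localMaximal volume (fun y => u y * α y) x) :=
          lintegral_const_mul' _ _ hNV
      _ ≤ N * V⁻¹ * (C₁ * V) := by
          refine mul_le_mul_right (hnear u α x₀ r hum hu4 hα2 (hαsupp.mono fun y hy hyB => ?_)) _
          exact hy fun h => hyB (ball_subset_ball (by linarith) h)
      _ = C₁ * N * (V⁻¹ * V) := by ring
      _ = C₁ * N := by rw [ENNReal.inv_mul_cancel hV0 hVt, mul_one]
  have hfar' : ∫⁻ x in (ball x₀ (2 * r))ᶜ, commutatorMaximal b a x ≤ C₂ * N := by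
    refine hfar b a (ballConst b) N x₀ r _ hosc hbm hr ha hba hsupp rfl ha1 ?_ ?_ ?_
    · refine hba1.trans ?_
      push_cast
      exact mul_le_mul_left le_self_add _
    · rw [← ENNReal.ofReal_pow (by positivity), ← ofReal_norm, div_pow, one_pow]
      exact ENNReal.ofReal_le_ofReal hmean
    · refine hmeanb.trans ?_
      rw [one_div, ENNReal.ofReal_inv_of_pos hlpos, ← div_eq_mul_inv]
      refine ENNReal.div_le_div_right (hexp.trans ?_) _
      push_cast
      gcongr
      calc (1 : ℝ≥0∞) ≤ 2 := one_le_two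
        _ ≤ 2 + K := le_self_add
  rw [← lintegral_add_compl _ measurableSet_ball, ENNReal.coe_add, add_mul]
  exact add_le_add hnear' hfar'

end LocalHardy

theorem proposition4p6 {𝕜 : Type*} [RCLike 𝕜] (n : ℕ) (hn : 1 ≤ n) :
    ∃ C : ℝ≥0, ∀ b a : EuclideanSpace ℝ (Fin n) → 𝕜,
      LocalHardy.IsBmo b → LocalHardy.IsApproxAtom b a →
        AEMeasurable (LocalHardy.commutatorMaximal b a) volume ∧
        ∫⁻ x, LocalHardy.commutatorMaximal b a x ≤ (C : ℝ≥0∞) * LocalHardy.bmoNorm b := by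
  obtain ⟨C, hC⟩ := LocalHardy.exists_lintegral_commutatorMaximal_le 𝕜 n
  refine ⟨C, fun b a hb ha => ?_⟩
  refine ⟨(hC b a ((LocalHardy.bmoNorm b).toNNReal + 1) (by positivity) hb.1 ?_ ha).1, ?_⟩
  · rw [ENNReal.coe_add, ENNReal.coe_toNNReal hb.2.ne]
    exact le_self_add
  have key : ∀ ε : ℝ≥0, 0 < ε → ∫⁻ x, LocalHardy.commutatorMaximal b a x ≤
      (C : ℝ≥0∞) * LocalHardy.bmoNorm b + C * ε := fun ε hε => by
    rw [← mul_add]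
    have h := (hC b a ((LocalHardy.bmoNorm b).toNNReal + ε) (by positivity) hb.1 (by
      rw [ENNReal.coe_add, ENNReal.coe_toNNReal hb.2.ne]; exact le_self_add) ha).2
    rwa [ENNReal.coe_add, ENNReal.coe_toNNReal hb.2.ne] at h
  refine ENNReal.le_of_forall_pos_le_add fun δ hδ _ => ?_
  refine (key (δ / (C + 1)) (by positivity)).trans (add_le_add_right ?_ _)
  rw [← ENNReal.coe_mul, ENNReal.coe_le_coe, mul_div_assoc', div_le_iff₀ (by positivity)]
  rw [mul_comm]
  gcongr
  exact le_self_add
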